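/- **Setting.** All manifolds are smooth, finite-dimensional, Hausdorff, $\sigma$-compact and without boundary; vector bundles are smooth of finite rank. A Lie algebroid is a vector bundle $\tau:E\to M$ with an anchor $\rho:E\to TM$ (a vector bundle map over $\mathrm{id}_M$) and a Lie bracket on its smooth sections such that $[\sigma,f\eta]=(\rho(\sigma)f)\,\eta+f[\sigma,\eta]$; it has the exterior differential $d$ on sections of $\wedge^\bullet E^*$ given by the Cartan formula. Let $E\to M$ and $E'\to M'$ be Lie algebroids and let $\Phi:E\to E'$ be a vector bundle map over a smooth map $\varphi:M\to M'$. It is a morphism if $\Phi^\star d\theta=d\Phi^\star\theta$ for all forms $\theta$ on $E'$ of all degrees, and it is fiberwise surjective if each $\Phi_x:E_x\to E'_{\varphi(x)}$ is onto. The prolongation $\mathcal T^EE\to E$ is the Lie algebroid with fibres $\mathcal T^E_aE=\{(b,v)\in E_{\tau(a)}\times T_aE : \rho(b)=T_a\tau(v)\}$, anchor $(a,b,v)\mapsto v$, and bracket of projectable sections $[(\sigma_1,U_1),(\sigma_2,U_2)]=([\sigma_1,\sigma_2],[U_1,U_2])$. With $b_a^{V}\in T_aE$ the vertical lift of $b$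 at $a$, put $S(a,b,v)=(a,0,b_a^{V})$ and $\Delta(a)=(a,0,a_a^{V})$. For $L\in C^\infty(E)$ let $\theta_L=S^*(dL)$, $\omega_L=-d\theta_L$ and $E_L=dL(\Delta)-L$, where $d$ is the differential of $\mathcal T^EE$. $L$ is regular at $a\in E$ if the bilinear form $\omega_L(a)$ on $\mathcal T^E_aE$ is nondegenerate; in this case $\Gamma_L(a)\in\mathcal T^E_aE$ denotes the unique solution of $i_{\Gamma_L(a)}\omega_L(a)=dE_L(a)$. $L$ is regular if it is regular at every point of $E$, and then $\Gamma_L$ is the Euler–Lagrange section. For a morphism $\Phi$ let $\mathcal T^\Phi\Phi:\mathcal T^EE\to\mathcal T^{E'}E'$, $\mathcal T^\Phi\Phi(a,b,v)=(\Phi(a),\Phi(b),T\Phi(v))$. **Theorem.** Let $\Phi:E\to E'$ be a fiberwise surjective morphism of Lie algebroids over $\varphi:M\to M'$, let $L\in C^\infty(E)$ and $L'\in C^\infty(E')$ satisfy $L=L'\circ\Phi$, and let $L$ be regular. Then $L'$ is regular at every point of $\Phi(E)$; in particular, if $\varphi$ is surjective, then $L'$ is a regular Lagrangian on $E'$. Moreover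 $$\mathcal T^\Phi\Phi\circ\Gamma_L=\Gamma_{L'}\circ\Phi .$$ -/

import Mathlib

open Bundle
open scoped Manifold ContDiff Topology

noncomputable section

namespace LieAlgd

section Generic

variable {EM : Type*} [NormedAddCommGroup EM] [NormedSpace ℝ EM]
  {HM : Type*} [TopologicalSpace HM] {I : ModelWithCorners ℝ EM HM}
  {M : Type*} [TopologicalSpace M] [ChartedSpace HM M]
  {V : M → Type*} [∀ x, AddCommGroup (V x)] [∀ x, Module ℝ (V x)]

/-- The bracket part of the Cartan formula for `dθ (σ₀, …, σₖ)`. The pairs of indices `p < q` of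
`σ₀, …, σₖ` are written as `p = i.castSucc`, `q = j.succ` with `i ≤ j`, so that the usual sign
`(-1) ^ (p + q)` is `(-1) ^ (i + j + 1)`. -/
def cartanBracketTerm {S : Type*} (ev : S → ∀ x, V x) (br : S → S → S) :
    ∀ {k : ℕ}, (∀ x, V x [⋀^Fin k]→ₗ[ℝ] ℝ) → (Fin (k + 1) → S) → M → ℝ
  | 0, _, _, _ => 0
  | k + 1, θ, σ, x => ∑ i : Fin (k + 1), ∑ j ∈ Finset.Ici i,
      (-1 : ℝ) ^ ((i : ℕ) + (j : ℕ) + 1) *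
        θ x (Matrix.vecCons (ev (br (σ i.castSucc) (σ j.succ)) x)
          (fun l => ev (σ (i.castSucc.succAbove (j.succAbove l))) x))

/-- The Cartan formula: the right-hand side of
`dθ (σ₀, …, σₖ) = ∑ᵢ (-1)ⁱ ρ(σᵢ) (θ (σ₀, …, σ̂ᵢ, …, σₖ))
  + ∑_{i < j} (-1)^{i + j} θ ([σᵢ, σⱼ], σ₀, …, σ̂ᵢ, …, σ̂ⱼ, …, σₖ)`,
for an anchor `ρ`, and for sections indexed by a type `S` (`ev s x` is the value at `x` of the
section with index `s`) with bracket `br`. -/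
def cartanFormula (I : ModelWithCorners ℝ EM HM) {S : Type*}
    (ρ : ∀ x : M, V x →ₗ[ℝ] TangentSpace I x)
    (ev : S → ∀ x, V x) (br : S → S → S) {k : ℕ}
    (θ : ∀ x, V x [⋀^Fin k]→ₗ[ℝ] ℝ) (σ : Fin (k + 1) → S) (x : M) : ℝ :=
  (∑ i : Fin (k + 1), (-1 : ℝ) ^ (i : ℕ) *
      mvfderiv I (fun y => θ y (fun l => ev (σ (i.succAbove l)) y)) x (ρ x (ev (σ i) x)))
    + cartanBracketTerm ev br θ σ x

/-- The exterior differential of a `k`-form `θ`: the `(k+1)`-form whose values on sections are given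
by the Cartan formula. For smooth `θ` on a Lie algebroid the right-hand side of that formula at `x`
depends only on the values of the sections at `x`, so that such a form exists; it is unique because
there is a section through every vector. (The value for other `θ` is irrelevant.) -/
def extDifferential (I : ModelWithCorners ℝ EM HM) {S : Type*}
    (ρ : ∀ x : M, V x →ₗ[ℝ] TangentSpace I x)
    (ev : S → ∀ x, V x) (br : S → S → S) {k : ℕ}
    (θ : ∀ x, V x [⋀^Fin k]→ₗ[ℝ] ℝ) : ∀ x, V x [⋀^Fin (k + 1)]→ₗ[ℝ] ℝ :=
  open Classical in
  if h : ∃ η : ∀ x, V x [⋀^Fin (k + 1)]→ₗ[ℝ] ℝ,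
      ∀ (σ : Fin (k + 1) → S) (x : M),
        η x (fun i => ev (σ i) x) = cartanFormula I ρ ev br θ σ x
  then h.choose else 0

/-- A form with the values of the Cartan formula is the exterior differential, as soon as there is a
section through every vector. -/
theorem extDifferential_eq {S : Type*}
    {ρ : ∀ x : M, V x →ₗ[ℝ] TangentSpace I x}
    {ev : S → ∀ x, V x} {br : S → S → S} {k : ℕ}
    {θ : ∀ x, V x [⋀^Fin k]→ₗ[ℝ] ℝ} {η : ∀ x, V x [⋀^Fin (k + 1)]→ₗ[ℝ] ℝ}
    (hev : ∀ (x : M) (v : V x), ∃ s : S, ev s x = v)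
    (hη : ∀ (σ : Fin (k + 1) → S) (x : M),
        η x (fun i => ev (σ i) x) = cartanFormula I ρ ev br θ σ x) :
    extDifferential I ρ ev br θ = η := by
  classical
  have h : ∃ η : ∀ x, V x [⋀^Fin (k + 1)]→ₗ[ℝ] ℝ,
      ∀ (σ : Fin (k + 1) → S) (x : M),
        η x (fun i => ev (σ i) x) = cartanFormula I ρ ev br θ σ x := ⟨η, hη⟩
  rw [extDifferential, dif_pos h]
  funext x
  ext v
  choose s hs using hev x
  have := (h.choose_spec (fun i => s (v i)) x).trans (hη (fun i => s (v i)) x).symm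
  simpa [hs] using this

/-- Smooth functions separate tangent vectors. -/
theorem eq_of_mvfderiv_eq [FiniteDimensional ℝ EM] [T2Space M] [IsManifold I ∞ M]
    {x : M} {v w : TangentSpace I x}
    (h : ∀ f : M → ℝ, ContMDiff I 𝓘(ℝ, ℝ) ∞ f → mvfderiv I f x v = mvfderiv I f x w) :
    v = w := by
  let b : SmoothBumpFunction I x := Classical.arbitrary _
  have key : ∀ ℓ : EM →L[ℝ] ℝ, ℓ (mfderiv I 𝓘(ℝ, EM) (extChartAt I x) x v)
      = ℓ (mfderiv I 𝓘(ℝ, EM) (extChartAt I x) x w) := by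
    intro ℓ
    have hs : ContMDiff I 𝓘(ℝ, ℝ) ∞ (fun y => b y • ℓ (extChartAt I x y)) := by
      apply b.contMDiff_smul
      exact ℓ.contMDiff.comp_contMDiffOn contMDiffOn_extChartAt
    have he : (fun y => b y • ℓ (extChartAt I x y)) =ᶠ[𝓝 x] (fun y => ℓ (extChartAt I x y)) := by
      filter_upwards [b.eventuallyEq_one] with y hy
      simp [hy]
    have hd : mvfderiv I (fun y => b y • ℓ (extChartAt I x y)) x
        = ℓ.comp (mfderiv I 𝓘(ℝ, EM) (extChartAt I x) x) := by
      rw [mvfderiv, he.mfderiv_eq]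
      have h1 : MDifferentiableAt I 𝓘(ℝ, EM) (extChartAt I x) x :=
        mdifferentiableAt_extChartAt (mem_chart_source _ x)
      have := (ℓ.hasMFDerivAt (x := extChartAt I x x)).comp x h1.hasMFDerivAt
      exact this.mfderiv
    have := h _ hs
    rw [hd] at this
    exact this
  have h2 : mfderiv I 𝓘(ℝ, EM) (extChartAt I x) x v = mfderiv I 𝓘(ℝ, EM) (extChartAt I x) x w := by
    by_contra hne
    obtain ⟨ℓ, hℓ⟩ := SeparatingDual.exists_ne_zero (R := ℝ) (V := EM) (sub_ne_zero.2 hne)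
    apply hℓ
    exact (map_sub ℓ _ _).trans (sub_eq_zero.2 (key ℓ))
  exact (isInvertible_mfderiv_extChartAt (mem_extChartAt_source x)).injective h2

/-- The derivative of a smooth function along a smooth family of tangent vectors is smooth. -/
theorem contMDiff_mvfderiv_apply [IsManifold I ∞ M]
    {EN : Type*} [NormedAddCommGroup EN] [NormedSpace ℝ EN]
    {HN : Type*} [TopologicalSpace HN] {J : ModelWithCorners ℝ EN HN}
    {N : Type*} [TopologicalSpace N] [ChartedSpace HN N]
    {f : M → ℝ} (hf : ContMDiff I 𝓘(ℝ, ℝ) ∞ f) {X : N → TangentBundle I M}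
    (hX : ContMDiff J I.tangent ∞ X) :
    ContMDiff J 𝓘(ℝ, ℝ) ∞ (fun n => mvfderiv I f (X n).proj (X n).2) := by
  have h1 : ContMDiff J 𝓘(ℝ, ℝ).tangent ∞ (fun n => tangentMap I 𝓘(ℝ, ℝ) f (X n)) :=
    (hf.contMDiff_tangentMap (m := ∞) (by simp)).comp hX
  exact contMDiff_snd_tangentBundle_modelSpace ℝ 𝓘(ℝ, ℝ) |>.comp h1

/-- The Lie bracket of vector fields acts on functions as a commutator. -/
theorem mvfderiv_mlieBracket [FiniteDimensional ℝ EM] [IsManifold I ∞ M]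
    {U W : ∀ x : M, TangentSpace I x}
    (hU : ContMDiff I I.tangent ∞ (fun x => (⟨x, U x⟩ : TangentBundle I M)))
    (hW : ContMDiff I I.tangent ∞ (fun x => (⟨x, W x⟩ : TangentBundle I M)))
    {f : M → ℝ} (hf : ContMDiff I 𝓘(ℝ, ℝ) ∞ f) (x : M) :
    mvfderiv I f x (VectorField.mlieBracket I U W x)
      = mvfderiv I (fun y => mvfderiv I f y (W y)) x (U x)
        - mvfderiv I (fun y => mvfderiv I f y (U y)) x (W x) := by
  have : CompleteSpace EM := FiniteDimensional.complete ℝ EM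
  have : IsManifold I (minSmoothness ℝ 3) M := by
    rw [minSmoothness_of_isRCLikeNormedField]
    exact IsManifold.of_le (n := ∞) (by norm_cast)
  have : IsManifold I (∞ + 1) M := by simpa using (inferInstanceAs (IsManifold I ∞ M))
  by_cases hz : ∃ z : EM, z ≠ 0
  swap
  · push Not at hz
    have h0 : ∀ (y : M) (z : TangentSpace I y), z = 0 := fun y z => hz z
    rw [h0 x (VectorField.mlieBracket I U W x), h0 x (U x), h0 x (W x)]
    simp
  obtain ⟨z, hz⟩ := hz
  let Z : ∀ y : M, TangentSpace I y := FiberBundle.extend EM (x := x) (show TangentSpace I x from z)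
  have hZx : Z x ≠ 0 := by
    have : Z x = (show TangentSpace I x from z) := FiberBundle.extend_apply_self _ _
    rw [this]; exact hz
  have hUf : ContMDiff I 𝓘(ℝ, ℝ) ∞ (fun y => mvfderiv I f y (U y)) := contMDiff_mvfderiv_apply hf hU
  have hWf : ContMDiff I 𝓘(ℝ, ℝ) ∞ (fun y => mvfderiv I f y (W y)) := contMDiff_mvfderiv_apply hf hW
  obtain ⟨s, hs, hZs⟩ := FiberBundle.exists_contMDiffOn_extend I EM (k := ∞)
    (show TangentSpace I x from z)
  have hZev : ∀ᶠ y in 𝓝 x, ContMDiffAt I I.tangent ∞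
      (fun x => (⟨x, Z x⟩ : TangentBundle I M)) y := by
    filter_upwards [eventually_mem_nhds_iff.2 hs] with y hy using hZs.contMDiffAt hy
  have hZ := hZev.self_of_nhds
  have top : (∞ : ℕ∞ω) ≠ 0 := by simp
  have hmin : minSmoothness ℝ 2 ≤ (∞ : ℕ∞ω) := by
    rw [minSmoothness_of_isRCLikeNormedField]; norm_cast
  have hmin' : minSmoothness ℝ ((⊤ : ℕ∞) + 1) ≤ ((⊤ : ℕ∞) : ℕ∞ω) := by
    rw [minSmoothness_of_isRCLikeNormedField]; norm_cast
  have hUZ : ContMDiffAt I I.tangent ∞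
      (fun y => (⟨y, VectorField.mlieBracket I U Z y⟩ : TangentBundle I M)) x :=
    ContMDiffAt.mlieBracket_vectorField (m := ⊤) (n := ⊤) (hU x) hZ hmin'
  have hWZ : ContMDiffAt I I.tangent ∞
      (fun y => (⟨y, VectorField.mlieBracket I W Z y⟩ : TangentBundle I M)) x :=
    ContMDiffAt.mlieBracket_vectorField (m := ⊤) (n := ⊤) (hW x) hZ hmin'
  -- the inner bracket with `f • Z`, near `x`
  have inner : ∀ {X : ∀ x : M, TangentSpace I x},
      ContMDiff I I.tangent ∞ (fun x => (⟨x, X x⟩ : TangentBundle I M)) →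
      VectorField.mlieBracket I X (f • Z) =ᶠ[𝓝 x]
        ((fun y => mvfderiv I f y (X y)) • Z + f • VectorField.mlieBracket I X Z) := by
    intro X hX
    filter_upwards [hZev] with y hy
    exact VectorField.mlieBracket_smul_right ((hf y).mdifferentiableAt top)
      (hy.mdifferentiableAt top)
  have outer : ∀ {X Y : ∀ x : M, TangentSpace I x},
      ContMDiff I I.tangent ∞ (fun x => (⟨x, X x⟩ : TangentBundle I M)) →
      ContMDiff I I.tangent ∞ (fun x => (⟨x, Y x⟩ : TangentBundle I M)) →
      VectorField.mlieBracket I X (VectorField.mlieBracket I Y (f • Z)) x =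
        (mvfderiv I (fun y => mvfderiv I f y (Y y)) x (X x) • Z x
          + mvfderiv I f x (Y x) • VectorField.mlieBracket I X Z x)
        + (mvfderiv I f x (X x) • VectorField.mlieBracket I Y Z x
          + f x • VectorField.mlieBracket I X (VectorField.mlieBracket I Y Z) x) := by
    intro X Y hX hY
    have hYf : ContMDiff I 𝓘(ℝ, ℝ) ∞ (fun y => mvfderiv I f y (Y y)) :=
      contMDiff_mvfderiv_apply hf hY
    have hYZ : ContMDiffAt I I.tangent ∞
        (fun y => (⟨y, VectorField.mlieBracket I Y Z y⟩ : TangentBundle I M)) x :=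
      ContMDiffAt.mlieBracket_vectorField (m := ⊤) (n := ⊤) (hY x) hZ hmin'
    refine (Filter.EventuallyEq.mlieBracket_vectorField_eq
      (Filter.EventuallyEq.refl _ X) (inner hY)).trans ?_
    rw [VectorField.mlieBracket_add_right
        (((hYf x).smul_section hZ).mdifferentiableAt top)
        (((hf x).smul_section hYZ).mdifferentiableAt top),
      VectorField.mlieBracket_smul_right ((hYf x).mdifferentiableAt top)
        (hZ.mdifferentiableAt top),
      VectorField.mlieBracket_smul_right ((hf x).mdifferentiableAt top)
        (hYZ.mdifferentiableAt top)]
  have hUW : ContMDiff I I.tangent ∞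
      (fun y => (⟨y, VectorField.mlieBracket I U W y⟩ : TangentBundle I M)) :=
    fun y => ContMDiffAt.mlieBracket_vectorField (m := ⊤) (n := ⊤) (hU y) (hW y) hmin'
  have jac := VectorField.leibniz_identity_mlieBracket_apply (I := I) (x := x)
    (U := U) (V := W) (W := f • Z) ((hU x).of_le hmin) ((hW x).of_le hmin)
    (((hf x).smul_section hZ).of_le hmin)
  have jac0 := VectorField.leibniz_identity_mlieBracket_apply (I := I) (x := x)
    (U := U) (V := W) (W := Z) ((hU x).of_le hmin) ((hW x).of_le hmin) (hZ.of_le hmin)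
  rw [outer hU hW, outer hW hU, (inner hUW).self_of_nhds, Pi.add_apply, jac0] at jac
  simp only [Pi.smul_apply', smul_add] at jac
  have : (mvfderiv I f x (VectorField.mlieBracket I U W x)
      - (mvfderiv I (fun y => mvfderiv I f y (W y)) x (U x)
        - mvfderiv I (fun y => mvfderiv I f y (U y)) x (W x))) • Z x = 0 := by
    rw [sub_smul, sub_smul, ← neg_eq_zero, ← sub_eq_zero.2 jac]
    abel
  exact sub_eq_zero.1 ((smul_eq_zero.1 this).resolve_right hZx)

end Generic

section Algebroid

variable {EM : Type*} [NormedAddCommGroup EM] [NormedSpace ℝ EM]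
  {M : Type*} [TopologicalSpace M] [ChartedSpace EM M]
  [IsManifold 𝓘(ℝ, EM) ∞ M]
  {F : Type*} [NormedAddCommGroup F] [NormedSpace ℝ F]
  {E : M → Type*} [TopologicalSpace (TotalSpace F E)] [∀ x, TopologicalSpace (E x)]
  [∀ x, AddCommGroup (E x)] [∀ x, Module ℝ (E x)] [FiberBundle F E] [VectorBundle ℝ F E]

/-- Product of a smooth function and a smooth section. -/
def smulSection (f : C^∞⟮𝓘(ℝ, EM), M; ℝ⟯) (σ : Cₛ^∞⟮𝓘(ℝ, EM); F, E⟯) :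
    Cₛ^∞⟮𝓘(ℝ, EM); F, E⟯ :=
  ⟨fun x => f x • σ x, f.contMDiff.smul_section σ.contMDiff⟩

/-- There is a smooth section through every vector of a vector bundle. -/
theorem exists_section [FiniteDimensional ℝ EM] [T2Space M] [SigmaCompactSpace M]
    [ContMDiffVectorBundle ∞ F E 𝓘(ℝ, EM)] (x : M) (v : E x) :
    ∃ σ : Cₛ^∞⟮𝓘(ℝ, EM); F, E⟯, σ x = v := by
  classical
  obtain ⟨σ, hσ⟩ := exists_contMDiffSection_forall_mem_convex_of_local (n := ⊤) 𝓘(ℝ, EM)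
    (F_fiber := F) E (fun y => {w | ∀ h : y = x, w = h ▸ v})
    (by
      intro y w hw w' hw' a b _ _ hab h
      subst h
      simp only [Set.mem_ofPred_eq, forall_const] at hw hw' ⊢
      simp [hw, hw', ← add_smul, hab])
    (by
      intro y
      by_cases hy : y = x
      · subst hy
        obtain ⟨s, hs, h⟩ := FiberBundle.exists_contMDiffOn_extend 𝓘(ℝ, EM) F (k := ∞) v
        refine ⟨s, hs, _, h, ?_⟩
        rintro z - rfl
        simp
      · refine ⟨{x}ᶜ, isOpen_compl_singleton.mem_nhds hy, fun _ => 0,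
          (0 : Cₛ^∞⟮𝓘(ℝ, EM); F, E⟯).contMDiff.contMDiffOn, ?_⟩
        intro z hz h
        exact absurd h hz)
  exact ⟨σ, hσ x rfl⟩

variable (EM F E) in
/-- A Lie algebroid structure on the smooth vector bundle `E → M`: an anchor `ρ : E → TM` (a smooth
vector bundle map over the identity) and a Lie bracket on the space of smooth sections of `E` such
that `[σ, f η] = (ρ(σ) f) η + f [σ, η]`. -/
structure LieAlgebroid where
  anchor : ∀ x : M, E x →ₗ[ℝ] TangentSpace 𝓘(ℝ, EM) x
  contMDiff_anchor : ContMDiff (𝓘(ℝ, EM).prod 𝓘(ℝ, F)) 𝓘(ℝ, EM).tangent ∞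
    (fun a : TotalSpace F E => (⟨a.proj, anchor a.proj a.2⟩ : TangentBundle 𝓘(ℝ, EM) M))
  bracket : Cₛ^∞⟮𝓘(ℝ, EM); F, E⟯ →ₗ[ℝ] Cₛ^∞⟮𝓘(ℝ, EM); F, E⟯ →ₗ[ℝ] Cₛ^∞⟮𝓘(ℝ, EM); F, E⟯
  bracket_self : ∀ σ, bracket σ σ = 0
  jacobi : ∀ σ η ζ,
    bracket σ (bracket η ζ) + bracket η (bracket ζ σ) + bracket ζ (bracket σ η) = 0
  leibniz : ∀ (f : C^∞⟮𝓘(ℝ, EM), M; ℝ⟯) (σ η : Cₛ^∞⟮𝓘(ℝ, EM); F, E⟯) (x : M),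
    bracket σ (smulSection f η) x =
      mvfderiv 𝓘(ℝ, EM) f x (anchor x (σ x)) • η x + f x • bracket σ η x

namespace LieAlgebroid

variable (A : LieAlgebroid EM F E)

/-- The exterior differential of the Lie algebroid `E` on forms, i.e. on sections of `⋀ᵏ E*`. -/
def d {k : ℕ} (θ : ∀ x, E x [⋀^Fin k]→ₗ[ℝ] ℝ) : ∀ x, E x [⋀^Fin (k + 1)]→ₗ[ℝ] ℝ :=
  extDifferential 𝓘(ℝ, EM) A.anchor (fun (σ : Cₛ^∞⟮𝓘(ℝ, EM); F, E⟯) x => σ x)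
    (fun σ η => A.bracket σ η) θ

/-- The vector field `ρ(σ)` of a section is smooth. -/
theorem contMDiff_anchor_section (σ : Cₛ^∞⟮𝓘(ℝ, EM); F, E⟯) :
    ContMDiff 𝓘(ℝ, EM) 𝓘(ℝ, EM).tangent ∞
      (fun x => (⟨x, A.anchor x (σ x)⟩ : TangentBundle 𝓘(ℝ, EM) M)) :=
  A.contMDiff_anchor.comp σ.contMDiff

/-- The derivative of a smooth function along a section. -/
def deriv (σ : Cₛ^∞⟮𝓘(ℝ, EM); F, E⟯) (f : C^∞⟮𝓘(ℝ, EM), M; ℝ⟯) :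
    C^∞⟮𝓘(ℝ, EM), M; ℝ⟯ :=
  ⟨fun x => mvfderiv 𝓘(ℝ, EM) f x (A.anchor x (σ x)),
    contMDiff_mvfderiv_apply f.contMDiff (A.contMDiff_anchor_section σ)⟩

/-- The anchor is a homomorphism of Lie algebras. -/
theorem mvfderiv_anchor_bracket [FiniteDimensional ℝ EM] [T2Space M] [SigmaCompactSpace M]
    [ContMDiffVectorBundle ∞ F E 𝓘(ℝ, EM)]
    (σ η : Cₛ^∞⟮𝓘(ℝ, EM); F, E⟯) (f : C^∞⟮𝓘(ℝ, EM), M; ℝ⟯) (x : M) :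
    mvfderiv 𝓘(ℝ, EM) f x (A.anchor x (A.bracket σ η x)) =
      A.deriv σ (A.deriv η f) x - A.deriv η (A.deriv σ f) x := by
  by_cases hz : ∃ z : F, z ≠ 0
  swap
  · push Not at hz
    have h0 : ∀ (y : M) (z : E y), z = 0 := fun y z =>
      (VectorBundle.continuousLinearEquivAt ℝ F E y).injective ((hz _).trans (hz _).symm)
    simp [deriv, h0 x (A.bracket σ η x), h0 x (σ x), h0 x (η x)]
  obtain ⟨z, hz⟩ := hz
  obtain ⟨Z, hZ⟩ := exists_section (F := F) (EM := EM) x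
    ((VectorBundle.continuousLinearEquivAt ℝ F E x).symm z)
  have hZx : Z x ≠ 0 := by
    rw [hZ, Ne, (VectorBundle.continuousLinearEquivAt ℝ F E x).symm.map_eq_zero_iff]; exact hz
  have lb : ∀ (f : C^∞⟮𝓘(ℝ, EM), M; ℝ⟯) (σ η : Cₛ^∞⟮𝓘(ℝ, EM); F, E⟯),
      A.bracket σ (smulSection f η) =
        smulSection (A.deriv σ f) η + smulSection f (A.bracket σ η) := by
    intro f σ η
    ext y
    exact A.leibniz f σ η y
  have skew : ∀ σ η, A.bracket σ η = - A.bracket η σ := by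
    intro σ η
    have := A.bracket_self (σ + η)
    simp only [map_add, LinearMap.add_apply, A.bracket_self, zero_add, add_zero] at this
    exact eq_neg_of_add_eq_zero_right this
  have jac : ∀ ζ, A.bracket σ (A.bracket η ζ) =
      A.bracket (A.bracket σ η) ζ + A.bracket η (A.bracket σ ζ) := by
    intro ζ
    have := A.jacobi σ η ζ
    rw [skew ζ σ, skew ζ (A.bracket σ η), map_neg] at this
    rw [← sub_eq_zero, ← this]; abel
  have j1 := congrArg (fun s => s x) (jac (smulSection f Z))
  have j0 := congrArg (fun s => s x) (jac Z)
  simp only [lb, map_add] at j1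
  simp only [ContMDiffSection.coe_add, Pi.add_apply] at j1 j0
  have sm : ∀ (g : C^∞⟮𝓘(ℝ, EM), M; ℝ⟯) (s : Cₛ^∞⟮𝓘(ℝ, EM); F, E⟯),
    smulSection g s x = g x • s x := fun _ _ => rfl
  simp only [sm, j0, smul_add] at j1
  have : ((A.deriv (A.bracket σ η) f) x
      - (A.deriv σ (A.deriv η f) x - A.deriv η (A.deriv σ f) x)) • Z x = 0 := by
    rw [sub_smul, sub_smul, ← neg_eq_zero, ← sub_eq_zero.2 j1]
    abel
  exact sub_eq_zero.1 ((smul_eq_zero.1 this).resolve_right hZx)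

end LieAlgebroid

/-! ### Forms and morphisms -/

/-- Smoothness of a `k`-form on `E`, that is, of a section of `⋀ᵏ E*`. -/
def IsSmoothForm {k : ℕ} (θ : ∀ x, E x [⋀^Fin k]→ₗ[ℝ] ℝ) : Prop :=
  ∀ σ : Fin k → Cₛ^∞⟮𝓘(ℝ, EM); F, E⟯,
    ContMDiff 𝓘(ℝ, EM) 𝓘(ℝ, ℝ) ∞ (fun x => θ x (fun i => σ i x))

variable {EM' : Type*} [NormedAddCommGroup EM'] [NormedSpace ℝ EM']
  {M' : Type*} [TopologicalSpace M'] [ChartedSpace EM' M'] [IsManifold 𝓘(ℝ, EM') ∞ M']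
  {F' : Type*} [NormedAddCommGroup F'] [NormedSpace ℝ F']
  {E' : M' → Type*} [TopologicalSpace (TotalSpace F' E')] [∀ x, TopologicalSpace (E' x)]
  [∀ x, AddCommGroup (E' x)] [∀ x, Module ℝ (E' x)] [FiberBundle F' E'] [VectorBundle ℝ F' E']

variable (EM F E EM' F' E') in
/-- A smooth vector bundle map `E → E'` over a smooth map `base : M → M'`. -/
structure VBMap where
  base : M → M'
  contMDiff_base : ContMDiff 𝓘(ℝ, EM) 𝓘(ℝ, EM') ∞ base
  fiber : ∀ x, E x →ₗ[ℝ] E' (base x)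
  contMDiff_total : ContMDiff (𝓘(ℝ, EM).prod 𝓘(ℝ, F)) (𝓘(ℝ, EM').prod 𝓘(ℝ, F')) ∞
    (fun a : TotalSpace F E => (⟨base a.proj, fiber a.proj a.2⟩ : TotalSpace F' E'))

namespace VBMap

variable (Φ : VBMap EM F E EM' F' E')

/-- The map of total spaces underlying a vector bundle map. -/
def total (a : TotalSpace F E) : TotalSpace F' E' := ⟨Φ.base a.proj, Φ.fiber a.proj a.2⟩

/-- The pullback of a form by a vector bundle map. -/
def pullback {k : ℕ} (θ : ∀ x, E' x [⋀^Fin k]→ₗ[ℝ] ℝ) : ∀ x, E x [⋀^Fin k]→ₗ[ℝ] ℝ :=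
  fun x => (θ (Φ.base x)).compLinearMap (Φ.fiber x)

/-- `Φ` is admissible if `ρ' ∘ Φ = Tφ ∘ ρ`, where `φ` is the base map of `Φ`. -/
def IsAdmissible (A : LieAlgebroid EM F E) (A' : LieAlgebroid EM' F' E') : Prop :=
  ∀ (x : M) (b : E x), A'.anchor (Φ.base x) (Φ.fiber x b) =
    mfderiv 𝓘(ℝ, EM) 𝓘(ℝ, EM') Φ.base x (A.anchor x b)

/-- `Φ` is a morphism of Lie algebroids if `Φ^⋆ dθ = d Φ^⋆ θ` for every smooth form `θ` on `E'` of
every degree. -/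
def IsMorphism (A : LieAlgebroid EM F E) (A' : LieAlgebroid EM' F' E') : Prop :=
  ∀ (k : ℕ) (θ : ∀ x, E' x [⋀^Fin k]→ₗ[ℝ] ℝ), IsSmoothForm (EM := EM') (F := F') θ →
    Φ.pullback (A'.d θ) = A.d (Φ.pullback θ)

/-- `Φ` is fiberwise surjective. -/
def IsFiberwiseSurjective : Prop := ∀ x, Function.Surjective (Φ.fiber x)

end VBMap

/-- The differential of a function `f`, as a `0`-form, is `σ ↦ ρ(σ) f`. -/
theorem LieAlgebroid.d_function [FiniteDimensional ℝ EM] [T2Space M] [SigmaCompactSpace M]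
    [ContMDiffVectorBundle ∞ F E 𝓘(ℝ, EM)] (A : LieAlgebroid EM F E) (f : M → ℝ) (x : M) (b : E x) :
    A.d (fun x => AlternatingMap.constOfIsEmpty ℝ (E x) (Fin 0) (f x)) x (fun _ => b) =
      mvfderiv 𝓘(ℝ, EM) f x (A.anchor x b) := by
  have : A.d (fun x => AlternatingMap.constOfIsEmpty ℝ (E x) (Fin 0) (f x)) =
      fun x => AlternatingMap.ofSubsingleton ℝ (E x) ℝ (0 : Fin 1)
        ((mvfderiv 𝓘(ℝ, EM) f x).toLinearMap ∘ₗ A.anchor x) := by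
    apply extDifferential_eq
    · exact fun x v => exists_section x v
    · intro σ x
      simp [cartanFormula, cartanBracketTerm]
  rw [this]
  simp

/-- Every morphism of Lie algebroids is admissible. -/
theorem VBMap.IsMorphism.isAdmissible [FiniteDimensional ℝ EM] [T2Space M] [SigmaCompactSpace M]
    [ContMDiffVectorBundle ∞ F E 𝓘(ℝ, EM)]
    [FiniteDimensional ℝ EM'] [T2Space M'] [SigmaCompactSpace M']
    [ContMDiffVectorBundle ∞ F' E' 𝓘(ℝ, EM')]
    {Φ : VBMap EM F E EM' F' E'} {A : LieAlgebroid EM F E} {A' : LieAlgebroid EM' F' E'}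
    (h : Φ.IsMorphism A A') : Φ.IsAdmissible A A' := by
  intro x b
  apply eq_of_mvfderiv_eq
  intro f hf
  have h1 := h 0 (fun x => AlternatingMap.constOfIsEmpty ℝ (E' x) (Fin 0) (f x))
    (fun σ => by simpa using hf)
  have h2 := congrArg (fun θ => θ (fun _ => b)) (congrFun h1 x)
  have h3 : Φ.pullback (fun x => AlternatingMap.constOfIsEmpty ℝ (E' x) (Fin 0) (f x)) =
      fun x => AlternatingMap.constOfIsEmpty ℝ (E x) (Fin 0) (f (Φ.base x)) := rfl
  have h4 : Φ.pullback (A'.d (fun x => AlternatingMap.constOfIsEmpty ℝ (E' x) (Fin 0) (f x))) x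
      (fun _ => b) = A'.d (fun x => AlternatingMap.constOfIsEmpty ℝ (E' x) (Fin 0) (f x))
        (Φ.base x) (fun _ => Φ.fiber x b) := rfl
  rw [h3] at h2
  have h5 := (h4.symm.trans h2).trans (A.d_function (fun x => f (Φ.base x)) x b)
  rw [A'.d_function] at h5
  rw [h5]
  have hc := mvfderiv_comp_apply (I := 𝓘(ℝ, EM')) (I' := 𝓘(ℝ, EM)) (f := Φ.base) (g := f) x
    ((hf (Φ.base x)).mdifferentiableAt (by simp))
    ((Φ.contMDiff_base x).mdifferentiableAt (by simp)) (A.anchor x b)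
  exact hc

/-! ### The prolongation `T^E E` of a Lie algebroid -/

set_option linter.unusedSectionVars false in
/-- The linear inclusion of a fibre of a vector bundle, read in a trivialization, is smooth. -/
theorem contMDiff_fiberInclusion [ContMDiffVectorBundle ∞ F E 𝓘(ℝ, EM)] (x : M) :
    ContMDiff 𝓘(ℝ, F) (𝓘(ℝ, EM).prod 𝓘(ℝ, F)) ∞
      (fun w : F => (⟨x, (VectorBundle.continuousLinearEquivAt ℝ F E x).symm w⟩ :
        TotalSpace F E)) := by
  intro w
  rw [contMDiffAt_totalSpace]
  refine ⟨contMDiffAt_const, ?_⟩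
  have : (fun w : F => (trivializationAt F E x
      (⟨x, (VectorBundle.continuousLinearEquivAt ℝ F E x).symm w⟩ : TotalSpace F E)).2) = id := by
    funext w
    exact (VectorBundle.continuousLinearEquivAt ℝ F E x).apply_symm_apply w
  exact (congrArg (fun g => ContMDiffAt 𝓘(ℝ, F) 𝓘(ℝ, F) ∞ g w) this).mpr contMDiffAt_id

/-- The vertical lift of `b ∈ E_x` at `a ∈ E_x`: the velocity at `t = 0` of `t ↦ a + t b`. -/
def verticalLift (a : TotalSpace F E) (b : E a.proj) :
    TangentSpace (𝓘(ℝ, EM).prod 𝓘(ℝ, F)) a :=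
  mfderiv 𝓘(ℝ, ℝ) (𝓘(ℝ, EM).prod 𝓘(ℝ, F))
    (fun t : ℝ => (⟨a.proj, a.2 + t • b⟩ : TotalSpace F E)) 0 (1 : ℝ)

theorem contMDiff_verticalCurve [ContMDiffVectorBundle ∞ F E 𝓘(ℝ, EM)]
    (a : TotalSpace F E) (b : E a.proj) :
    ContMDiff 𝓘(ℝ, ℝ) (𝓘(ℝ, EM).prod 𝓘(ℝ, F)) ∞
      (fun t : ℝ => (⟨a.proj, a.2 + t • b⟩ : TotalSpace F E)) := by
  let e := VectorBundle.continuousLinearEquivAt ℝ F E a.proj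
  have h1 : (fun t : ℝ => (⟨a.proj, a.2 + t • b⟩ : TotalSpace F E)) =
      (fun w : F => (⟨a.proj, e.symm w⟩ : TotalSpace F E)) ∘ (fun t : ℝ => e a.2 + t • e b) := by
    funext t
    have : e.symm (e a.2 + t • e b) = a.2 + t • b := by
      rw [map_add, map_smul, e.symm_apply_apply, e.symm_apply_apply]
    exact congrArg (fun w => (⟨a.proj, w⟩ : TotalSpace F E)) this.symm
  rw [h1]
  apply (contMDiff_fiberInclusion a.proj).comp
  rw [contMDiff_iff_contDiff]
  fun_prop

theorem exists_verticalLift_eq [ContMDiffVectorBundle ∞ F E 𝓘(ℝ, EM)] (a : TotalSpace F E) :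
    ∃ D : F →L[ℝ] EM × F, ∀ b : E a.proj, (verticalLift (EM := EM) a b : EM × F) =
      D (VectorBundle.continuousLinearEquivAt ℝ F E a.proj b) := by
  refine ⟨mfderiv 𝓘(ℝ, F) (𝓘(ℝ, EM).prod 𝓘(ℝ, F))
    (fun w : F => (⟨a.proj, (VectorBundle.continuousLinearEquivAt ℝ F E a.proj).symm w⟩ :
      TotalSpace F E)) (VectorBundle.continuousLinearEquivAt ℝ F E a.proj a.2), ?_⟩
  intro b
  let e := VectorBundle.continuousLinearEquivAt ℝ F E a.proj
  have h1 : (fun t : ℝ => (⟨a.proj, a.2 + t • b⟩ : TotalSpace F E)) =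
      (fun w : F => (⟨a.proj, e.symm w⟩ : TotalSpace F E)) ∘
        (fun t : ℝ => e a.2 + t • e b) := by
    funext t
    have : e.symm (e a.2 + t • e b) = a.2 + t • b := by
      rw [map_add, map_smul, e.symm_apply_apply, e.symm_apply_apply]
    exact congrArg (fun w => (⟨a.proj, w⟩ : TotalSpace F E)) this.symm
  have h2 : HasFDerivAt (fun t : ℝ => e a.2 + t • e b)
      ((ContinuousLinearMap.id ℝ ℝ).smulRight (e b)) 0 :=
    ((hasFDerivAt_id (𝕜 := ℝ) (0 : ℝ)).smul_const (e b)).const_add _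
  have h3 := ((contMDiff_fiberInclusion (EM := EM) (F := F) (E := E) a.proj)
    ((fun t : ℝ => e a.2 + t • e b) 0)).mdifferentiableAt (by simp)
  have h4 := (h3.hasMFDerivAt.comp (0 : ℝ) h2.hasMFDerivAt).mfderiv
  have h5 : (fun t : ℝ => e a.2 + t • e b) 0 = e a.2 := by simp
  rw [h5] at h4
  rw [← h1] at h4
  have h6 := congrArg (fun T : ℝ →L[ℝ] EM × F => T 1) h4
  have h7 : ((ContinuousLinearMap.id ℝ ℝ).smulRight (e b) : ℝ →L[ℝ] F) 1 = e b :=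
    one_smul ℝ (e b)
  exact h6.trans (congrArg (mfderiv 𝓘(ℝ, F) (𝓘(ℝ, EM).prod 𝓘(ℝ, F))
    (fun w : F => (⟨a.proj, e.symm w⟩ : TotalSpace F E)) (e a.2)) h7)

/-- The vertical lift as a linear map. -/
def verticalLiftₗ [ContMDiffVectorBundle ∞ F E 𝓘(ℝ, EM)] (a : TotalSpace F E) :
    E a.proj →ₗ[ℝ] TangentSpace (𝓘(ℝ, EM).prod 𝓘(ℝ, F)) a where
  toFun := verticalLift a
  map_add' b c := by
    obtain ⟨D, hD⟩ := exists_verticalLift_eq (EM := EM) a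
    have h := hD (b + c)
    rw [map_add, map_add, ← hD b, ← hD c] at h
    exact h
  map_smul' r b := by
    obtain ⟨D, hD⟩ := exists_verticalLift_eq (EM := EM) a
    have h := hD (r • b)
    rw [map_smul, map_smul, ← hD b] at h
    exact h

/-- Vertical lifts project to zero. -/
theorem mfderiv_proj_verticalLift [ContMDiffVectorBundle ∞ F E 𝓘(ℝ, EM)]
    (a : TotalSpace F E) (b : E a.proj) :
    mfderiv (𝓘(ℝ, EM).prod 𝓘(ℝ, F)) 𝓘(ℝ, EM) (TotalSpace.proj : TotalSpace F E → M) a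
      (verticalLift a b) = 0 := by
  have h0 : (fun t : ℝ => (⟨a.proj, a.2 + t • b⟩ : TotalSpace F E)) 0 = a := by simp
  have h1 := ((contMDiff_verticalCurve (EM := EM) a b) 0).mdifferentiableAt (by simp)
  have h2 : MDifferentiableAt (𝓘(ℝ, EM).prod 𝓘(ℝ, F)) 𝓘(ℝ, EM)
      (TotalSpace.proj : TotalSpace F E → M)
      ((fun t : ℝ => (⟨a.proj, a.2 + t • b⟩ : TotalSpace F E)) 0) :=
    ((contMDiff_proj E).mdifferentiableAt (n := ∞) (by simp))
  have h3 := (h2.hasMFDerivAt.comp (0 : ℝ) h1.hasMFDerivAt).mfderiv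
  rw [h0] at h3
  have h4 := mfderiv_const (I := 𝓘(ℝ, ℝ)) (I' := 𝓘(ℝ, EM)) (c := a.proj) (x := (0 : ℝ))
  have h5 := congrArg (fun T : ℝ →L[ℝ] EM => T 1) (h3.symm.trans h4)
  exact h5

namespace LieAlgebroid

variable (A : LieAlgebroid EM F E)

/-- The fibre `T^E_a E = {(b, v) ∈ E_x × T_a E | ρ(b) = T_a τ (v)}`, `x = τ(a)`, of the
prolongation `T^E E → E` of the Lie algebroid `τ : E → M`. -/
def prol (a : TotalSpace F E) :
    Submodule ℝ (E a.proj × TangentSpace (𝓘(ℝ, EM).prod 𝓘(ℝ, F)) a) where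
  carrier := {z | A.anchor a.proj z.1 =
    mfderiv (𝓘(ℝ, EM).prod 𝓘(ℝ, F)) 𝓘(ℝ, EM) (TotalSpace.proj : TotalSpace F E → M) a z.2}
  add_mem' {z w} hz hw := by
    simp only [Set.mem_ofPred_eq, Prod.fst_add, Prod.snd_add, map_add] at hz hw ⊢
    rw [hz, hw]
  zero_mem' := by simp
  smul_mem' r z hz := by
    simp only [Set.mem_ofPred_eq, Prod.smul_fst, Prod.smul_snd, map_smul] at hz ⊢
    rw [hz]

/-- The anchor `(a, b, v) ↦ v` of the prolongation. -/
def prolAnchor (a : TotalSpace F E) :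
    A.prol a →ₗ[ℝ] TangentSpace (𝓘(ℝ, EM).prod 𝓘(ℝ, F)) a :=
  LinearMap.snd ℝ _ _ ∘ₗ (A.prol a).subtype

/-- The projectable sections `a ↦ (a, σ(τ(a)), U(a))` of `T^E E`, where `σ` is a section of `E` and
`U` is a vector field on the manifold `E`. -/
structure ProjectableSection [ContMDiffVectorBundle ∞ F E 𝓘(ℝ, EM)] where
  base : Cₛ^∞⟮𝓘(ℝ, EM); F, E⟯
  field : ∀ a : TotalSpace F E, TangentSpace (𝓘(ℝ, EM).prod 𝓘(ℝ, F)) a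
  contMDiff_field : ContMDiff (𝓘(ℝ, EM).prod 𝓘(ℝ, F)) (𝓘(ℝ, EM).prod 𝓘(ℝ, F)).tangent ∞
    (fun a => (⟨a, field a⟩ : TangentBundle (𝓘(ℝ, EM).prod 𝓘(ℝ, F)) (TotalSpace F E)))
  mem_prol : ∀ a, (base a.proj, field a) ∈ A.prol a

namespace ProjectableSection

variable {A} [ContMDiffVectorBundle ∞ F E 𝓘(ℝ, EM)]

/-- The value of a projectable section at a point of `E`. -/
def eval (Z : A.ProjectableSection) (a : TotalSpace F E) : A.prol a :=
  ⟨(Z.base a.proj, Z.field a), Z.mem_prol a⟩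

/-- The bracket of projectable sections,
`[(σ₁, U₁), (σ₂, U₂)] = ([σ₁, σ₂], [U₁, U₂])`. -/
def bracket [FiniteDimensional ℝ EM] [T2Space M] [SigmaCompactSpace M]
    [FiniteDimensional ℝ F] (Z W : A.ProjectableSection) : A.ProjectableSection where
  base := A.bracket Z.base W.base
  field := VectorField.mlieBracket (𝓘(ℝ, EM).prod 𝓘(ℝ, F)) Z.field W.field
  contMDiff_field := by
    have : CompleteSpace EM := FiniteDimensional.complete ℝ EM
    have : CompleteSpace F := FiniteDimensional.complete ℝ F
    have : IsManifold (𝓘(ℝ, EM).prod 𝓘(ℝ, F)) (minSmoothness ℝ 3) (TotalSpace F E) := by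
      rw [minSmoothness_of_isRCLikeNormedField]
      exact IsManifold.of_le (n := ∞) (by norm_cast)
    have : IsManifold (𝓘(ℝ, EM).prod 𝓘(ℝ, F)) (∞ + 1) (TotalSpace F E) := by
      simpa using (inferInstanceAs (IsManifold (𝓘(ℝ, EM).prod 𝓘(ℝ, F)) ∞ (TotalSpace F E)))
    have hmin' : minSmoothness ℝ ((⊤ : ℕ∞) + 1) ≤ ((⊤ : ℕ∞) : ℕ∞ω) := by
      rw [minSmoothness_of_isRCLikeNormedField]; norm_cast
    exact fun y => ContMDiffAt.mlieBracket_vectorField (m := ⊤) (n := ⊤)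
      (Z.contMDiff_field y) (W.contMDiff_field y) hmin'
  mem_prol := by
    intro a
    have hpi : ContMDiff (𝓘(ℝ, EM).prod 𝓘(ℝ, F)) 𝓘(ℝ, EM) ∞
        (TotalSpace.proj : TotalSpace F E → M) := contMDiff_proj E
    have top : (∞ : ℕ∞ω) ≠ 0 := by simp
    have chain : ∀ (f : C^∞⟮𝓘(ℝ, EM), M; ℝ⟯) (b : TotalSpace F E)
        (v : TangentSpace (𝓘(ℝ, EM).prod 𝓘(ℝ, F)) b),
        mvfderiv (𝓘(ℝ, EM).prod 𝓘(ℝ, F)) (fun c : TotalSpace F E => f c.proj) b v =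
          mvfderiv 𝓘(ℝ, EM) f b.proj (mfderiv (𝓘(ℝ, EM).prod 𝓘(ℝ, F)) 𝓘(ℝ, EM)
            (TotalSpace.proj : TotalSpace F E → M) b v) := by
      intro f b v
      exact mvfderiv_comp_apply (I := 𝓘(ℝ, EM)) (I' := 𝓘(ℝ, EM).prod 𝓘(ℝ, F))
        (f := (TotalSpace.proj : TotalSpace F E → M)) (g := f) b
        ((f.contMDiff b.proj).mdifferentiableAt top) ((hpi b).mdifferentiableAt top) v
    have rel : ∀ (Y : A.ProjectableSection) (f : C^∞⟮𝓘(ℝ, EM), M; ℝ⟯) (b : TotalSpace F E),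
        mvfderiv (𝓘(ℝ, EM).prod 𝓘(ℝ, F)) (fun c : TotalSpace F E => f c.proj) b (Y.field b) =
          A.deriv Y.base f b.proj := by
      intro Y f b
      rw [chain, ← show A.anchor b.proj (Y.base b.proj) = _ from Y.mem_prol b]
      rfl
    change A.anchor a.proj (A.bracket Z.base W.base a.proj) = _
    apply eq_of_mvfderiv_eq
    intro f hf
    let f' : C^∞⟮𝓘(ℝ, EM), M; ℝ⟯ := ⟨f, hf⟩
    refine (A.mvfderiv_anchor_bracket Z.base W.base f' a.proj).trans ?_
    refine Eq.trans ?_ (chain f' a _)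
    have hff : ContMDiff (𝓘(ℝ, EM).prod 𝓘(ℝ, F)) 𝓘(ℝ, ℝ) ∞
      (fun c : TotalSpace F E => f' c.proj) := hf.comp hpi
    rw [mvfderiv_mlieBracket Z.contMDiff_field W.contMDiff_field hff a]
    simp only [rel]

end ProjectableSection

section Lagrangian

variable [ContMDiffVectorBundle ∞ F E 𝓘(ℝ, EM)]

/-- The vertical endomorphism `S (a, b, v) = (a, 0, b_a^V)` of `T^E E`. -/
def verticalEndomorphism (a : TotalSpace F E) : A.prol a →ₗ[ℝ] A.prol a :=
  LinearMap.codRestrict (A.prol a)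
    (LinearMap.inr ℝ _ _ ∘ₗ verticalLiftₗ a ∘ₗ LinearMap.fst ℝ _ _ ∘ₗ (A.prol a).subtype)
    (fun z => by
      change A.anchor a.proj 0 = _
      rw [map_zero]
      exact (mfderiv_proj_verticalLift a z.1.1).symm)

/-- The Liouville section `Δ (a) = (a, 0, a_a^V)` of `T^E E`. -/
def liouvilleSection (a : TotalSpace F E) : A.prol a :=
  ⟨(0, verticalLift a a.2), by
    change A.anchor a.proj 0 = _
    rw [map_zero]
    exact (mfderiv_proj_verticalLift a a.2).symm⟩

/-- The differential `df (z) = ρ(z) f` on the Lie algebroid `T^E E` of a function `f` on `E`. -/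
def prolDFun (f : TotalSpace F E → ℝ) (a : TotalSpace F E) : A.prol a →ₗ[ℝ] ℝ :=
  (mvfderiv (𝓘(ℝ, EM).prod 𝓘(ℝ, F)) f a).toLinearMap ∘ₗ A.prolAnchor a

/-- The Lagrangian energy `E_L = 𝓛_Δ L - L`. -/
def energy (L : TotalSpace F E → ℝ) (a : TotalSpace F E) : ℝ :=
  A.prolDFun L a (A.liouvilleSection a) - L a

/-- The Cartan `1`-section `θ_L = S^* (dL)`. -/
def cartanOne (L : TotalSpace F E → ℝ) (a : TotalSpace F E) : A.prol a [⋀^Fin 1]→ₗ[ℝ] ℝ :=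
  AlternatingMap.ofSubsingleton ℝ (A.prol a) ℝ (0 : Fin 1)
    (A.prolDFun L a ∘ₗ A.verticalEndomorphism a)

variable [FiniteDimensional ℝ EM] [T2Space M] [SigmaCompactSpace M] [FiniteDimensional ℝ F]

/-- The exterior differential of the Lie algebroid `T^E E`. As projectable sections generate all
sections of `T^E E` locally, it is determined by the Cartan formula for projectable sections. -/
def prolD {k : ℕ} (θ : ∀ a : TotalSpace F E, A.prol a [⋀^Fin k]→ₗ[ℝ] ℝ) :
    ∀ a : TotalSpace F E, A.prol a [⋀^Fin (k + 1)]→ₗ[ℝ] ℝ :=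
  extDifferential (𝓘(ℝ, EM).prod 𝓘(ℝ, F)) A.prolAnchor
    (fun Z : A.ProjectableSection => Z.eval) ProjectableSection.bracket θ

/-- The Cartan `2`-section `ω_L = - dθ_L`. -/
def cartanTwo (L : TotalSpace F E → ℝ) (a : TotalSpace F E) : A.prol a [⋀^Fin 2]→ₗ[ℝ] ℝ :=
  - A.prolD (A.cartanOne L) a

/-- The Lagrangian `L` is regular at `a ∈ E` if the bilinear form `ω_L (a)` on `T^E_a E` is
nondegenerate. -/
def IsRegularAt (L : TotalSpace F E → ℝ) (a : TotalSpace F E) : Prop :=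
  ∀ z : A.prol a, (∀ w : A.prol a, A.cartanTwo L a ![z, w] = 0) → z = 0

/-- The Lagrangian `L` is regular if `ω_L` is nondegenerate at every point of `E`. -/
def IsRegular (L : TotalSpace F E → ℝ) : Prop := ∀ a, A.IsRegularAt L a

/-- The equation `i_z ω_L = dE_L` at the point `a`. -/
def IsDynamicsAt (L : TotalSpace F E → ℝ) (a : TotalSpace F E) (z : A.prol a) : Prop :=
  ∀ w : A.prol a, A.cartanTwo L a ![z, w] = A.prolDFun (A.energy L) a w

/-- At a point where `L` is regular, the equation `i_z ω_L = dE_L` has exactly one solution. -/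
theorem existsUnique_isDynamicsAt {L : TotalSpace F E → ℝ} {a : TotalSpace F E}
    (h : A.IsRegularAt L a) : ∃! z : A.prol a, A.IsDynamicsAt L a z := by
  have : FiniteDimensional ℝ (E a.proj) := VectorBundle.finiteDimensional ℝ F E a.proj
  have : FiniteDimensional ℝ (TangentSpace (𝓘(ℝ, EM).prod 𝓘(ℝ, F)) a) :=
    inferInstanceAs (FiniteDimensional ℝ (EM × F))
  have : FiniteDimensional ℝ (A.prol a) := inferInstance
  have u0 : ∀ z w y : A.prol a, Function.update ![z, w] 0 y = ![y, w] := by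
    intro z w y; funext i; fin_cases i <;> rfl
  have u1 : ∀ z w y : A.prol a, Function.update ![z, w] 1 y = ![z, y] := by
    intro z w y; funext i; fin_cases i <;> rfl
  let B : A.prol a →ₗ[ℝ] Module.Dual ℝ (A.prol a) := LinearMap.mk₂ ℝ
    (fun z w => A.cartanTwo L a ![z, w])
    (fun z z' w => by
      have := (A.cartanTwo L a).map_update_add ![z, w] 0 z z'
      rwa [u0, u0, u0] at this)
    (fun r z w => by
      have := (A.cartanTwo L a).map_update_smul ![z, w] 0 r z
      rwa [u0, u0] at this)
    (fun z w w' => by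
      have := (A.cartanTwo L a).map_update_add ![z, w] 1 w w'
      rwa [u1, u1, u1] at this)
    (fun r z w => by
      have := (A.cartanTwo L a).map_update_smul ![z, w] 1 r w
      rwa [u1, u1] at this)
  have hB : Function.Injective B := by
    rw [← LinearMap.ker_eq_bot, LinearMap.ker_eq_bot']
    intro z hz
    exact h z (fun w => LinearMap.congr_fun hz w)
  have hB' : Function.Surjective B :=
    (LinearMap.injective_iff_surjective_of_finrank_eq_finrank
      (Subspace.dual_finrank_eq).symm).1 hB
  obtain ⟨z, hz⟩ := hB' (A.prolDFun (A.energy L) a)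
  refine ⟨z, fun w => LinearMap.congr_fun hz w, fun z' hz' => hB ?_⟩
  rw [hz]
  ext w
  exact hz' w

/-- The value `Γ_L (a) ∈ T^E_a E` of the Euler-Lagrange section at a point where `L` is regular: the
solution of `i_Γ ω_L = dE_L`. -/
def eulerLagrange (L : TotalSpace F E → ℝ) (a : TotalSpace F E) (h : A.IsRegularAt L a) :
    A.prol a :=
  (A.existsUnique_isDynamicsAt h).choose

end Lagrangian

end LieAlgebroid

/-- The prolongation `T^Φ Φ : T^E E → T^{E'} E'`, `(a, b, v) ↦ (Φ(a), Φ(b), TΦ(v))`, of an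
admissible map `Φ`. -/
def VBMap.prolong [ContMDiffVectorBundle ∞ F E 𝓘(ℝ, EM)] [ContMDiffVectorBundle ∞ F' E' 𝓘(ℝ, EM')]
    (Φ : VBMap EM F E EM' F' E')
    {A : LieAlgebroid EM F E} {A' : LieAlgebroid EM' F' E'} (h : Φ.IsAdmissible A A')
    (a : TotalSpace F E) : A.prol a →ₗ[ℝ] A'.prol (Φ.total a) :=
  LinearMap.codRestrict (A'.prol (Φ.total a))
    (((Φ.fiber a.proj).prodMap
      (mfderiv (𝓘(ℝ, EM).prod 𝓘(ℝ, F)) (𝓘(ℝ, EM').prod 𝓘(ℝ, F')) Φ.total a).toLinearMap) ∘ₗ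
        (A.prol a).subtype)
    (fun z => by
      have top : (∞ : ℕ∞ω) ≠ 0 := by simp
      have h1 : HasMFDerivAt (𝓘(ℝ, EM).prod 𝓘(ℝ, F)) 𝓘(ℝ, EM')
          (fun c : TotalSpace F E => Φ.base c.proj) a _ :=
        ((Φ.contMDiff_base a.proj).mdifferentiableAt top).hasMFDerivAt.comp a
          (((contMDiff_proj E (n := ∞) (IB := 𝓘(ℝ, EM)) (F := F))
            a).mdifferentiableAt top).hasMFDerivAt
      have h2 : HasMFDerivAt (𝓘(ℝ, EM).prod 𝓘(ℝ, F)) 𝓘(ℝ, EM')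
          (fun c : TotalSpace F E => Φ.base c.proj) a _ :=
        (((contMDiff_proj E' (n := ∞) (IB := 𝓘(ℝ, EM')) (F := F'))
          (Φ.total a)).mdifferentiableAt top).hasMFDerivAt.comp a
            ((Φ.contMDiff_total a).mdifferentiableAt top).hasMFDerivAt
      have h3 := congrArg (fun T : EM × F →L[ℝ] EM' => T z.1.2) (hasMFDerivAt_unique h1 h2)
      have h4 : A.anchor a.proj z.1.1 = _ := z.2
      refine (h a.proj z.1.1).trans ?_
      rw [h4]
      exact h3)

end Algebroid
end LieAlgd

end

/-! The theorem is naturality of the dynamical equation under pullback. Write `T` for the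
prolongation of `Φ`. If `T^* ω_{L'} = ω_L`, `T^* dE_{L'} = dE_L` and `T` is fibrewise onto, then
everything follows at a point `a`. A vector in the kernel of `ω_{L'}` at `Φ(a)` is `T z` with `z` in
the kernel of `ω_L`, hence zero; and `T Γ_L(a)` satisfies the equation for `L'` against every `T w`,
hence against every vector, so it is `Γ_{L'}(Φ(a))` by uniqueness.

Surjectivity of `T` (`prolong_surjective`) uses fibrewise surjectivity twice: on the component in
`E`, then on the vertical correction of the tangent component. The energy identity follows from the
chain rule, because `TΦ` maps vertical lifts to vertical lifts.

The substance is `IsMorphism.cartanTwo_eq`. The bracket on the prolongation is specified by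
projectable sections, which need not be related by `Φ`. Instead, `θ_L` is treated as a family of
covectors `β_c ∈ E*_{τ(c)}` along `τ : E → M`, namely the fibre derivatives of `L`. By tensoriality
(`exists_differential`, `cartanTwo_apply`), for `z = (b, v)`, `w = (c, u)` and any sections `σ`, `η`
of `E` through `b`, `c`, `ω_L(z, w) = -(v(β η) - u(β σ) - β [σ, η])`.

On the target, take any sections `σ'`, `η'` through `Φ(b)`, `Φ(c)` and a `1`-form `α` on `E'` that
equals the fibre derivative of `L'` at `Φ(a)`. The morphism property for `α` compares the brackets
`[σ, η]` and `[σ', η']`. The error made by using `α` in place of the fibre derivatives is the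
derivative at `a` of a pairing of two factors which both vanish at `a`, so it is zero
(`mvfderiv_pairing_eq_zero`). Only degrees `0` (admissibility) and `1` of the morphism property
enter. -/

open Bundle
open scoped Manifold ContDiff Topology

noncomputable section

set_option linter.unusedSectionVars false

namespace LieAlgd

/-! ### Global sections forming local frames -/

section Frames

variable {EM : Type*} [NormedAddCommGroup EM] [NormedSpace ℝ EM]
  {M : Type*} [TopologicalSpace M] [ChartedSpace EM M]
  {F : Type*} [NormedAddCommGroup F] [NormedSpace ℝ F]
  {E : M → Type*} [TopologicalSpace (TotalSpace F E)] [∀ x, TopologicalSpace (E x)]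
  [∀ x, AddCommGroup (E x)] [∀ x, Module ℝ (E x)] [FiberBundle F E] [VectorBundle ℝ F E]

/-- Near every point, finitely many global smooth sections form a frame, whose coordinate functions
are the restrictions of global smooth fibrewise linear functions. -/
theorem exists_frame [FiniteDimensional ℝ EM] [T2Space M] [IsManifold 𝓘(ℝ, EM) ∞ M]
    [FiniteDimensional ℝ F] [ContMDiffVectorBundle ∞ F E 𝓘(ℝ, EM)] (x : M) :
    ∃ (r : ℕ) (e : Fin r → Cₛ^∞⟮𝓘(ℝ, EM); F, E⟯) (κ : Fin r → ∀ y, E y →ₗ[ℝ] ℝ),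
      (∀ i, ContMDiff (𝓘(ℝ, EM).prod 𝓘(ℝ, F)) 𝓘(ℝ, ℝ) ∞
        (fun c : TotalSpace F E => κ i c.proj c.2)) ∧
      ∀ᶠ y in 𝓝 x, ∀ w : E y, w = ∑ i, κ i y w • e i y := by
  classical
  let t := trivializationAt F E x
  have hx : x ∈ t.baseSet := mem_baseSet_trivializationAt F E x
  let b := Module.finBasis ℝ F
  -- One bump function cuts off both the local frame and its dual coordinates. Both extend smoothly
  -- by zero, and near `x`, where `ψ = 1`, the expansion in the frame is unchanged.
  obtain ⟨ψ, -, hψ⟩ := (SmoothBumpFunction.nhds_basis_tsupport (I := 𝓘(ℝ, EM)) x).mem_iff.1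
    (t.open_baseSet.mem_nhds hx)
  have hf : ∀ i, ContMDiff 𝓘(ℝ, EM) (𝓘(ℝ, EM).prod 𝓘(ℝ, F)) ∞
      (fun y => (⟨y, ψ y • t.localFrame b i y⟩ : TotalSpace F E)) := fun i =>
    ContMDiffOn.smul_section_of_tsupport ψ.contMDiff.contMDiffOn t.open_baseSet hψ
      (t.contMDiffOn_localFrame_baseSet ∞ b i)
  refine ⟨_, fun i => ⟨_, hf i⟩, fun i y => ψ y • (b.coord i ∘ₗ t.linearMapAt ℝ y), fun i c => ?_, ?_⟩
  · by_cases hc : c.proj ∈ t.baseSet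
    · have h1 : ContMDiffAt (𝓘(ℝ, EM).prod 𝓘(ℝ, F)) 𝓘(ℝ, F) ∞
          (fun c : TotalSpace F E => (t c).2) c :=
        ((t.contMDiffOn (n := ∞) (IB := 𝓘(ℝ, EM))).contMDiffAt
          (t.open_source.mem_nhds (t.mem_source.2 hc))).snd
      have h2 : ContMDiffAt (𝓘(ℝ, EM).prod 𝓘(ℝ, F)) 𝓘(ℝ, ℝ) ∞
          (fun c : TotalSpace F E => ψ c.proj * b.coord i (t c).2) c :=
        ((ψ.contMDiff.comp (contMDiff_proj E)) c).mul
          ((b.coord i).toContinuousLinearMap.contMDiff.contMDiffAt.comp c h1)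
      refine h2.congr_of_eventuallyEq ?_
      filter_upwards [t.open_source.mem_nhds (t.mem_source.2 hc)] with d hd
      have : t.linearMapAt ℝ d.proj d.2 = (t d).2 := by
        rw [t.linearMapAt_apply, if_pos (t.mem_source.1 hd)]
      simp [this]
    · have h0 : (fun c : TotalSpace F E => (ψ c.proj • (b.coord i ∘ₗ t.linearMapAt ℝ c.proj)) c.2)
          =ᶠ[𝓝 c] fun _ => 0 := by
        have : ∀ᶠ y in 𝓝 c.proj, ψ y = 0 := by
          have := notMem_tsupport_iff_eventuallyEq.1 (fun h => hc (hψ h))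
          exact this
        filter_upwards [(FiberBundle.continuous_proj F E).continuousAt.eventually this] with d hd
        simp [hd]
      exact contMDiffAt_const.congr_of_eventuallyEq h0
  · filter_upwards [ψ.eventuallyEq_one, t.open_baseSet.mem_nhds hx] with y hy hyb w
    have := (t.basisAt b hyb).sum_repr w
    have h1 : ψ y = 1 := hy
    conv_lhs => rw [← this]
    refine Finset.sum_congr rfl fun i _ => ?_
    change _ = (ψ y • (b.coord i ∘ₗ t.linearMapAt ℝ y)) w • (ψ y • t.localFrame b i y)
    simp [h1, hyb, Trivialization.basisAt]

end Frames

/-! ### Covector families along a map and tensoriality of their differential -/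

section Tensoriality

variable {EM : Type*} [NormedAddCommGroup EM] [NormedSpace ℝ EM]
  {M : Type*} [TopologicalSpace M] [ChartedSpace EM M] [IsManifold 𝓘(ℝ, EM) ∞ M]
  {F : Type*} [NormedAddCommGroup F] [NormedSpace ℝ F]
  {E : M → Type*} [TopologicalSpace (TotalSpace F E)] [∀ x, TopologicalSpace (E x)]
  [∀ x, AddCommGroup (E x)] [∀ x, Module ℝ (E x)] [FiberBundle F E] [VectorBundle ℝ F E]
  {EN : Type*} [NormedAddCommGroup EN] [NormedSpace ℝ EN]
  {HN : Type*} [TopologicalSpace HN] (J : ModelWithCorners ℝ EN HN)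
  {N : Type*} [TopologicalSpace N] [ChartedSpace HN N]

/-- The pairing of a smooth section with a smooth fibrewise linear function is smooth. -/
def coordSection (κ : ∀ y, E y →ₗ[ℝ] ℝ)
    (hκ : ContMDiff (𝓘(ℝ, EM).prod 𝓘(ℝ, F)) 𝓘(ℝ, ℝ) ∞ (fun c : TotalSpace F E => κ c.proj c.2))
    (σ : Cₛ^∞⟮𝓘(ℝ, EM); F, E⟯) : C^∞⟮𝓘(ℝ, EM), M; ℝ⟯ :=
  ⟨fun y => κ y (σ y), hκ.comp σ.contMDiff⟩

/-- A section vanishing at `x` is a finite sum of products `f s` with `f` a function vanishing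
at `x`. -/
theorem mem_closure_smulSection_of_eq_zero [FiniteDimensional ℝ EM] [T2Space M]
    [FiniteDimensional ℝ F] [ContMDiffVectorBundle ∞ F E 𝓘(ℝ, EM)]
    {σ : Cₛ^∞⟮𝓘(ℝ, EM); F, E⟯} {x : M} (hσ : σ x = 0) :
    σ ∈ AddSubmonoid.closure
      {s | ∃ (f : C^∞⟮𝓘(ℝ, EM), M; ℝ⟯) (η : Cₛ^∞⟮𝓘(ℝ, EM); F, E⟯),
        f x = 0 ∧ s = smulSection f η} := by
  obtain ⟨r, e, κ, hκ, hfr⟩ := exists_frame (F := F) (E := E) (EM := EM) x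
  -- Subtracting the global frame expansion leaves a remainder `τ` that vanishes on the support of
  -- `ψ`. Hence `(1 - ψ) τ = τ`, and `1 - ψ` vanishes at `x`; so do the coefficients `κ i (σ)`.
  obtain ⟨ψ, -, hψ⟩ := (SmoothBumpFunction.nhds_basis_tsupport (I := 𝓘(ℝ, EM)) x).mem_iff.1 hfr
  let g : C^∞⟮𝓘(ℝ, EM), M; ℝ⟯ := ⟨fun y => 1 - ψ y, contMDiff_const.sub ψ.contMDiff⟩
  let τ : Cₛ^∞⟮𝓘(ℝ, EM); F, E⟯ := σ - ∑ i, smulSection (coordSection (κ i) (hκ i) σ) (e i)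
  have hτ : ∀ y, τ y = σ y - ∑ i, κ i y (σ y) • e i y := by
    intro y
    simp only [τ, ContMDiffSection.coe_sub, Pi.sub_apply]
    congr 1
    have := map_sum (ContMDiffSection.coeAddHom 𝓘(ℝ, EM) F ∞ E)
      (fun i => smulSection (coordSection (κ i) (hκ i) σ) (e i)) Finset.univ
    have := congrFun this y
    rw [Finset.sum_apply] at this
    exact this
  have h : σ = ∑ i, smulSection (coordSection (κ i) (hκ i) σ) (e i) + smulSection g τ := by
    have : smulSection g τ = τ := by
      ext y
      change (1 - ψ y) • τ y = τ y
      by_cases hy : y ∈ tsupport ψ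
      · have : τ y = 0 := by rw [hτ]; exact sub_eq_zero.2 (hψ hy (σ y))
        simp [this]
      · simp [image_eq_zero_of_notMem_tsupport hy]
    rw [this]; simp [τ]
  rw [h]
  refine add_mem (sum_mem fun i _ => AddSubmonoid.subset_closure ⟨_, _, ?_, rfl⟩)
    (AddSubmonoid.subset_closure ⟨g, τ, ?_, rfl⟩)
  · change κ i x (σ x) = 0
    rw [hσ, map_zero]
  · change 1 - ψ x = 0
    rw [ψ.eq_one, sub_self]

variable (EM F) in
/-- A family of covectors `β n` of `E` along a map `ϕ` is smooth if its pairing with every smooth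
section of `E` is. -/
def IsSmoothCovectorFamily {ϕ : N → M} (β : ∀ n, E (ϕ n) →ₗ[ℝ] ℝ) : Prop :=
  ∀ σ : Cₛ^∞⟮𝓘(ℝ, EM); F, E⟯, ContMDiff J 𝓘(ℝ, ℝ) ∞ (fun n => β n (σ (ϕ n)))

variable {J}

namespace IsSmoothCovectorFamily

variable {ϕ : N → M} {β : ∀ n, E (ϕ n) →ₗ[ℝ] ℝ} (hβ : IsSmoothCovectorFamily EM F J β)

include hβ in
theorem mdifferentiableAt (σ : Cₛ^∞⟮𝓘(ℝ, EM); F, E⟯) (n : N) :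
    MDifferentiableAt J 𝓘(ℝ, ℝ) (fun n => β n (σ (ϕ n))) n :=
  (hβ σ n).mdifferentiableAt (by simp)

/-- The derivative at `n` of the pairing with a section, as a linear map. -/
def derivPairing (n : N) :
    Cₛ^∞⟮𝓘(ℝ, EM); F, E⟯ →ₗ[ℝ] (TangentSpace J n →L[ℝ] ℝ) where
  toFun σ := mvfderiv J (fun n => β n (σ (ϕ n))) n
  map_add' σ η := by
    rw [← mvfderiv_add (hβ.mdifferentiableAt σ n) (hβ.mdifferentiableAt η n)]
    congr 1
    funext m
    exact map_add (β m) _ _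
  map_smul' r σ := by
    have h := mvfderiv_smul (I := J) (x := n) (a := fun _ => r) mdifferentiableAt_const
      (hβ.mdifferentiableAt σ n)
    rw [mvfderiv_const] at h
    have h' : (fun m => β m ((r • σ) (ϕ m))) = (fun _ : N => r) • fun m => β m (σ (ϕ m)) := by
      funext m
      exact map_smul (β m) _ _
    rw [h', h]
    ext v
    simp

/-- The Leibniz rule for `β(f σ)` has two terms, and the one with the factor `f (ϕ n)` drops out.
The surviving term has the same shape as the anchor term in the Leibniz identity of the bracket. -/
theorem derivPairing_smulSection {n : N} (hϕ : MDifferentiableAt J 𝓘(ℝ, EM) ϕ n)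
    {f : C^∞⟮𝓘(ℝ, EM), M; ℝ⟯} (hf : f (ϕ n) = 0) (σ : Cₛ^∞⟮𝓘(ℝ, EM); F, E⟯)
    (u : TangentSpace J n) :
    hβ.derivPairing n (smulSection f σ) u =
      mvfderiv 𝓘(ℝ, EM) f (ϕ n) (mfderiv J 𝓘(ℝ, EM) ϕ n u) * β n (σ (ϕ n)) := by
  have h1 : MDifferentiableAt 𝓘(ℝ, EM) 𝓘(ℝ, ℝ) f (ϕ n) :=
    (f.contMDiff (ϕ n)).mdifferentiableAt (by simp)
  have h2 : (fun m => β m (smulSection f σ (ϕ m))) =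
      (f ∘ ϕ) * (fun m => β m (σ (ϕ m))) := by
    funext m
    exact map_smul (β m) _ _
  change mvfderiv J (fun m => β m (smulSection f σ (ϕ m))) n u = _
  rw [h2, mvfderiv_mul (h1.comp n hϕ) (hβ.mdifferentiableAt σ n), ← mvfderiv_comp_apply n h1 hϕ u]
  simp [hf, mul_comm]

/-- The pairing with a section vanishing at `ϕ n` is differentiated by the Lie bracket. -/
theorem derivPairing_of_eq_zero [FiniteDimensional ℝ EM] [T2Space M]
    [FiniteDimensional ℝ F] [ContMDiffVectorBundle ∞ F E 𝓘(ℝ, EM)] (A : LieAlgebroid EM F E)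
    {n : N} (hϕ : MDifferentiableAt J 𝓘(ℝ, EM) ϕ n) {σ η : Cₛ^∞⟮𝓘(ℝ, EM); F, E⟯}
    (hσ : σ (ϕ n) = 0) {u : TangentSpace J n}
    (hu : A.anchor (ϕ n) (η (ϕ n)) = mfderiv J 𝓘(ℝ, EM) ϕ n u) :
    hβ.derivPairing n σ u = β n (A.bracket η σ (ϕ n)) := by
  -- Both sides are additive in `σ`, so a product `f s` with `f (ϕ n) = 0` suffices. There both
  -- sides are `(ρ(η) f) β(s)`, because `hu` identifies the velocity of `ϕ` along `u` with the
  -- anchor of `η`.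
  refine AddSubmonoid.closure_induction
    (motive := fun σ _ => hβ.derivPairing n σ u = β n (A.bracket η σ (ϕ n)))
    ?_ ?_ ?_ (mem_closure_smulSection_of_eq_zero hσ)
  · rintro _ ⟨f, s, hf, rfl⟩
    rw [hβ.derivPairing_smulSection hϕ hf, A.leibniz, hf, zero_smul, add_zero, map_smul, hu]
    rfl
  · simp
  · intro s t _ _ hs ht
    rw [map_add, map_add, ContMDiffSection.coe_add, Pi.add_apply, map_add, ← hs, ← ht]
    rfl

variable {V : Type*} [AddCommGroup V] [Module ℝ V]

/-- The exterior differential of a smooth covector family along `ϕ`, as a `2`-form: its value on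
vectors `z`, `w` with components `(b, v)` and `(c, u)` in `E ×_{TM} TN` is given by the Cartan
formula for arbitrary sections of `E` through `b` and `c`. -/
theorem exists_differential [FiniteDimensional ℝ EM] [T2Space M] [SigmaCompactSpace M]
    [FiniteDimensional ℝ F] [ContMDiffVectorBundle ∞ F E 𝓘(ℝ, EM)] (A : LieAlgebroid EM F E)
    {n : N} (hϕ : MDifferentiableAt J 𝓘(ℝ, EM) ϕ n)
    (p : V →ₗ[ℝ] E (ϕ n)) (q : V →ₗ[ℝ] TangentSpace J n)
    (hpq : ∀ z, A.anchor (ϕ n) (p z) = mfderiv J 𝓘(ℝ, EM) ϕ n (q z)) :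
    ∃ Ω : V [⋀^Fin 2]→ₗ[ℝ] ℝ, ∀ (z : Fin 2 → V) (σ η : Cₛ^∞⟮𝓘(ℝ, EM); F, E⟯),
      σ (ϕ n) = p (z 0) → η (ϕ n) = p (z 1) →
      Ω z = hβ.derivPairing n η (q (z 0)) - hβ.derivPairing n σ (q (z 1))
        - β n (A.bracket σ η (ϕ n)) := by
  let ev : Cₛ^∞⟮𝓘(ℝ, EM); F, E⟯ →ₗ[ℝ] E (ϕ n) :=
    { toFun := fun σ => σ (ϕ n), map_add' := fun _ _ => rfl, map_smul' := fun _ _ => rfl }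
  -- A linear choice of sections through the vectors of the fibre makes `B` below bilinear; nothing
  -- else about `l` matters.
  obtain ⟨l, hl⟩ := ev.exists_rightInverse_of_surjective
    (LinearMap.range_eq_top.2 fun v => exists_section (ϕ n) v)
  have hl : ∀ b, l b (ϕ n) = b := fun b => LinearMap.congr_fun hl b
  have skew : ∀ σ η, A.bracket σ η = - A.bracket η σ := by
    intro σ η
    have := A.bracket_self (σ + η)
    simp only [map_add, LinearMap.add_apply, A.bracket_self, zero_add, add_zero] at this
    exact eq_neg_of_add_eq_zero_right this
  let B : V → V → ℝ := fun z w => hβ.derivPairing n (l (p w)) (q z)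
    - hβ.derivPairing n (l (p z)) (q w) - (β n ∘ₗ ev) (A.bracket (l (p z)) (l (p w)))
  have hB : ∀ z w, B w z = - B z w := by
    intro z w
    simp only [B, skew (l (p w)), map_neg]
    ring
  have hadd : ∀ z z' w, B z (w + z') = B z w + B z z' := by
    intro z z' w
    simp only [B, map_add, add_apply]
    ring
  have hsmul : ∀ z w (r : ℝ), B z (r • w) = r • B z w := by
    intro z w r
    simp only [B, map_smul, smul_apply, smul_eq_mul]
    ring
  have hadd' : ∀ z z' w, B (z + z') w = B z w + B z' w := by
    intro z z' w
    rw [hB w, hB w, hB w, hadd, neg_add]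
  have hsmul' : ∀ z w (r : ℝ), B (r • z) w = r • B z w := by
    intro z w r
    rw [hB w, hB w, hsmul, smul_neg]
  refine ⟨AlternatingMap.mk
    { toFun := fun z => B (z 0) (z 1)
      map_update_add' := fun z i x y => ?_
      map_update_smul' := fun z i r x => ?_ } ?_, fun z σ η hσ hη => ?_⟩
  · fin_cases i <;> simp [hadd, hadd']
  · fin_cases i <;> simp [hsmul, hsmul']
  · intro z i j hij hne
    have h1 : z 0 = z 1 := by
      obtain ⟨rfl, rfl⟩ | ⟨rfl, rfl⟩ : i = 0 ∧ j = 1 ∨ i = 1 ∧ j = 0 := by omega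
      exacts [hij, hij.symm]
    have h := hB (z 1) (z 1)
    change B (z 0) (z 1) = 0
    rw [h1]
    linarith
  · change B (z 0) (z 1) = _
    -- Independence of the sections: pass from `(l (p (z 0)), l (p (z 1)))` to `(σ, η)` through `(σ,
    -- l (p (z 1)))`. Each exchange alters one section by one that vanishes at `ϕ n`, and the change
    -- of the derivative cancels that of the bracket.
    have h1 := hβ.derivPairing_of_eq_zero A hϕ (σ := η - l (p (z 1))) (η := σ) (u := q (z 0))
      (by simp [hl, hη]) (by rw [hσ, hpq])
    have h2 := hβ.derivPairing_of_eq_zero A hϕ (σ := σ - l (p (z 0))) (η := l (p (z 1)))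
      (u := q (z 1)) (by simp [hl, hσ]) (by rw [hl, hpq])
    simp only [map_sub, LinearMap.sub_apply, sub_apply, ContMDiffSection.coe_sub, Pi.sub_apply,
      skew (l (p (z 1))), ContMDiffSection.coe_neg, Pi.neg_apply, map_neg] at h1 h2
    change _ - _ - β n (A.bracket (l (p (z 0))) (l (p (z 1))) (ϕ n)) = _
    linarith

end IsSmoothCovectorFamily

end Tensoriality

/-- Tangent vectors at points that are only provably equal have different types; comparing them in
the model space avoids a transport. -/
theorem tangentBundle_mk_eq {EN : Type*} [NormedAddCommGroup EN] [NormedSpace ℝ EN]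
    {HN : Type*} [TopologicalSpace HN] {J : ModelWithCorners ℝ EN HN}
    {N : Type*} [TopologicalSpace N] [ChartedSpace HN N] {x y : N} (h : x = y)
    {v : TangentSpace J x} {w : TangentSpace J y} (hvw : (v : EN) = w) :
    (⟨x, v⟩ : TangentBundle J N) = ⟨y, w⟩ := by
  subst h
  exact congrArg _ hvw

/-! ### Vertical and horizontal directions on the total space -/

section TotalSpaceGeometry

variable {EM : Type*} [NormedAddCommGroup EM] [NormedSpace ℝ EM]
  {M : Type*} [TopologicalSpace M] [ChartedSpace EM M] [IsManifold 𝓘(ℝ, EM) ∞ M]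
  {F : Type*} [NormedAddCommGroup F] [NormedSpace ℝ F]
  {E : M → Type*} [TopologicalSpace (TotalSpace F E)] [∀ x, TopologicalSpace (E x)]
  [∀ x, AddCommGroup (E x)] [∀ x, Module ℝ (E x)] [FiberBundle F E] [VectorBundle ℝ F E]
  [ContMDiffVectorBundle ∞ F E 𝓘(ℝ, EM)]

/-- In the chart at `a`, the derivative of the projection is the first projection. -/
theorem mfderiv_proj_apply (a : TotalSpace F E) (v : TangentSpace (𝓘(ℝ, EM).prod 𝓘(ℝ, F)) a) :
    (mfderiv (𝓘(ℝ, EM).prod 𝓘(ℝ, F)) 𝓘(ℝ, EM) (TotalSpace.proj : TotalSpace F E → M) a v : EM) =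
      (show EM × F from v).1 := by
  have h : MDifferentiableAt (𝓘(ℝ, EM).prod 𝓘(ℝ, F)) 𝓘(ℝ, EM)
      (TotalSpace.proj : TotalSpace F E → M) a :=
    (contMDiff_proj E (n := ∞) a).mdifferentiableAt (by simp)
  -- The chart at `a` is a trivialization followed by the base chart at `a.proj`, so in charts the
  -- projection is `Prod.fst`.
  have hev : writtenInExtChartAt (𝓘(ℝ, EM).prod 𝓘(ℝ, F)) 𝓘(ℝ, EM) a
      (TotalSpace.proj : TotalSpace F E → M) =ᶠ[𝓝 (extChartAt (𝓘(ℝ, EM).prod 𝓘(ℝ, F)) a a)]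
      Prod.fst := by
    filter_upwards [extChartAt_target_mem_nhds (I := 𝓘(ℝ, EM).prod 𝓘(ℝ, F)) a] with y hy
    have hy' : y ∈ (chartAt (ModelProd EM F) a).target := hy.2
    have h1 := FiberBundle.chartedSpace_chartAt_symm_fst a y hy'
    have h2 : y.1 ∈ (chartAt EM a.proj).target := by
      rw [FiberBundle.chartedSpace_chartAt] at hy'
      simp only [mfld_simps] at hy'
      exact hy'.1
    change chartAt EM a.proj ((chartAt (ModelProd EM F) a).symm y).proj = y.1
    rw [h1]
    exact (chartAt EM a.proj).right_inv h2
  have h2 : HasFDerivWithinAt (writtenInExtChartAt (𝓘(ℝ, EM).prod 𝓘(ℝ, F)) 𝓘(ℝ, EM) a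
      (TotalSpace.proj : TotalSpace F E → M)) (ContinuousLinearMap.fst ℝ EM F)
      (Set.range (𝓘(ℝ, EM).prod 𝓘(ℝ, F)))
      (extChartAt (𝓘(ℝ, EM).prod 𝓘(ℝ, F)) a a) :=
    (hasFDerivAt_fst.congr_of_eventuallyEq hev).hasFDerivWithinAt
  have h3 : HasMFDerivAt (𝓘(ℝ, EM).prod 𝓘(ℝ, F)) 𝓘(ℝ, EM)
      (TotalSpace.proj : TotalSpace F E → M) a (ContinuousLinearMap.fst ℝ EM F) :=
    ⟨h.continuousAt, h2⟩
  rw [h3.mfderiv]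
  rfl

/-- In the chart at `a`, vertical lifts are the vectors of the second factor. -/
theorem verticalLift_eq (a : TotalSpace F E) (b : E a.proj) :
    (verticalLift (EM := EM) a b : EM × F) =
      (0, VectorBundle.continuousLinearEquivAt ℝ F E a.proj b) := by
  let e := VectorBundle.continuousLinearEquivAt ℝ F E a.proj
  have h := (contMDiff_verticalCurve (EM := EM) a b 0).mdifferentiableAt (by simp)
  have h1 : writtenInExtChartAt 𝓘(ℝ, ℝ) (𝓘(ℝ, EM).prod 𝓘(ℝ, F)) (0 : ℝ)
      (fun t : ℝ => (⟨a.proj, a.2 + t • b⟩ : TotalSpace F E)) =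
      fun t : ℝ => (extChartAt 𝓘(ℝ, EM) a.proj a.proj, e a.2 + t • e b) := by
    funext t
    have : e (a.2 + t • b) = e a.2 + t • e b := by simp
    rw [← this]
    simp only [writtenInExtChartAt, FiberBundle.extChartAt]
    refine Prod.ext ?_ rfl
    exact congrArg (extChartAt 𝓘(ℝ, EM) a.proj) ((trivializationAt F E a.proj).coe_fst'
      (mem_baseSet_trivializationAt F E a.proj))
  have h2 : HasFDerivAt (fun t : ℝ => (extChartAt 𝓘(ℝ, EM) a.proj a.proj, e a.2 + t • e b))
      ((0 : ℝ →L[ℝ] EM).prod ((ContinuousLinearMap.id ℝ ℝ).smulRight (e b))) 0 :=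
    (hasFDerivAt_const _ _).prodMk (((hasFDerivAt_id (𝕜 := ℝ) (0 : ℝ)).smul_const (e b)).const_add _)
  have h3 : HasMFDerivAt 𝓘(ℝ, ℝ) (𝓘(ℝ, EM).prod 𝓘(ℝ, F))
      (fun t : ℝ => (⟨a.proj, a.2 + t • b⟩ : TotalSpace F E)) 0
      ((0 : ℝ →L[ℝ] EM).prod ((ContinuousLinearMap.id ℝ ℝ).smulRight (e b))) := by
    refine ⟨h.continuousAt, ?_⟩
    rw [h1]
    exact h2.hasFDerivWithinAt
  rw [verticalLift, h3.mfderiv]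
  refine Prod.ext rfl ?_
  exact one_smul ℝ (e b)

/-- The vectors tangent to the fibres are the vertical lifts. -/
theorem exists_verticalLift_eq_of_mfderiv_proj_eq_zero {a : TotalSpace F E}
    {v : TangentSpace (𝓘(ℝ, EM).prod 𝓘(ℝ, F)) a}
    (hv : mfderiv (𝓘(ℝ, EM).prod 𝓘(ℝ, F)) 𝓘(ℝ, EM) (TotalSpace.proj : TotalSpace F E → M) a v = 0) :
    ∃ b, verticalLift a b = v := by
  refine ⟨(VectorBundle.continuousLinearEquivAt ℝ F E a.proj).symm (show EM × F from v).2, ?_⟩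
  refine (verticalLift_eq a _).trans ?_
  rw [ContinuousLinearEquiv.apply_symm_apply]
  exact Prod.ext ((mfderiv_proj_apply a v).symm.trans hv).symm rfl

theorem mfderiv_proj_surjective (a : TotalSpace F E) (w : TangentSpace 𝓘(ℝ, EM) a.proj) :
    ∃ v : TangentSpace (𝓘(ℝ, EM).prod 𝓘(ℝ, F)) a,
      mfderiv (𝓘(ℝ, EM).prod 𝓘(ℝ, F)) 𝓘(ℝ, EM) (TotalSpace.proj : TotalSpace F E → M) a v = w :=
  ⟨(show EM × F from (w, 0)), mfderiv_proj_apply a _⟩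

/-- Fibrewise translation by multiples of a smooth fibre-preserving map is smooth. -/
theorem contMDiff_fiberTranslation {W : ∀ c : TotalSpace F E, E c.proj}
    (hW : ContMDiff (𝓘(ℝ, EM).prod 𝓘(ℝ, F)) (𝓘(ℝ, EM).prod 𝓘(ℝ, F)) ∞
      (fun c => (⟨c.proj, W c⟩ : TotalSpace F E))) :
    ContMDiff (𝓘(ℝ, ℝ).prod (𝓘(ℝ, EM).prod 𝓘(ℝ, F))) (𝓘(ℝ, EM).prod 𝓘(ℝ, F)) ∞
      (fun p : ℝ × TotalSpace F E => (⟨p.2.proj, p.2.2 + p.1 • W p.2⟩ : TotalSpace F E)) := by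
  intro p
  let t := trivializationAt F E p.2.proj
  have hp : p.2.proj ∈ t.baseSet := mem_baseSet_trivializationAt F E _
  have hpr : ContMDiffAt (𝓘(ℝ, ℝ).prod (𝓘(ℝ, EM).prod 𝓘(ℝ, F))) 𝓘(ℝ, EM) ∞
      (fun p : ℝ × TotalSpace F E => p.2.proj) p :=
    ((contMDiff_proj E).comp contMDiff_snd) p
  rw [contMDiffAt_totalSpace]
  refine ⟨hpr, ?_⟩
  have h1 := ((contMDiffAt_totalSpace (n := ∞) (IB := 𝓘(ℝ, EM))
    (IM := 𝓘(ℝ, ℝ).prod (𝓘(ℝ, EM).prod 𝓘(ℝ, F))) (f := fun p : ℝ × TotalSpace F E => p.2) (x₀ := p)).1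
    contMDiffAt_snd).2
  have h2 := ((contMDiffAt_totalSpace (n := ∞) (IB := 𝓘(ℝ, EM))
    (IM := 𝓘(ℝ, ℝ).prod (𝓘(ℝ, EM).prod 𝓘(ℝ, F))) (f := fun p : ℝ × TotalSpace F E =>
    (⟨p.2.proj, W p.2⟩ : TotalSpace F E)) (x₀ := p)).1 ((hW.comp contMDiff_snd) p)).2
  refine (h1.add ((contMDiffAt_fst (I := 𝓘(ℝ, ℝ)) (J := 𝓘(ℝ, EM).prod 𝓘(ℝ, F))).smul h2)).congr_of_eventuallyEq ?_
  filter_upwards [hpr.continuousAt.preimage_mem_nhds (t.open_baseSet.mem_nhds hp)] with q hq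
  change (t ⟨q.2.proj, q.2.2 + q.1 • W q.2⟩).2 = (t ⟨q.2.proj, q.2.2⟩).2 +
    q.1 • (t ⟨q.2.proj, W q.2⟩).2
  have h := fun w => t.linearMapAt_apply (R := ℝ) (b := q.2.proj) w
  simp only [if_pos (show q.2.proj ∈ t.baseSet from hq)] at h
  rw [← h, ← h, ← h, map_add, map_smul]

/-- The vertical lift of a smooth fibre-preserving map is a smooth vector field. -/
theorem contMDiff_verticalLift {W : ∀ c : TotalSpace F E, E c.proj}
    (hW : ContMDiff (𝓘(ℝ, EM).prod 𝓘(ℝ, F)) (𝓘(ℝ, EM).prod 𝓘(ℝ, F)) ∞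
      (fun c => (⟨c.proj, W c⟩ : TotalSpace F E))) :
    ContMDiff (𝓘(ℝ, EM).prod 𝓘(ℝ, F)) (𝓘(ℝ, EM).prod 𝓘(ℝ, F)).tangent ∞
      (fun c => (⟨c, verticalLift c (W c)⟩ :
        TangentBundle (𝓘(ℝ, EM).prod 𝓘(ℝ, F)) (TotalSpace F E))) := by
  -- With `G (t, c) = c + t W(c)`, the vertical lift of `W(c)` is `TG (∂_t, 0)` at `(0, c)`, so it
  -- inherits smoothness from the tangent map of `G`.
  have hG := contMDiff_fiberTranslation hW
  have h1 := hG.contMDiff_tangentMap (m := ∞) (by simp)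
  have h2 : ContMDiff (𝓘(ℝ, EM).prod 𝓘(ℝ, F)) (𝓘(ℝ, EM).prod 𝓘(ℝ, F)).tangent ∞
      (fun c : TotalSpace F E => (⟨c, 0⟩ :
        TangentBundle (𝓘(ℝ, EM).prod 𝓘(ℝ, F)) (TotalSpace F E))) :=
    contMDiff_zeroSection ℝ _
  have h3 : ContMDiff (𝓘(ℝ, EM).prod 𝓘(ℝ, F)) 𝓘(ℝ, ℝ).tangent ∞
      (fun c : TotalSpace F E => (⟨0, (1 : ℝ)⟩ : TangentBundle 𝓘(ℝ, ℝ) ℝ)) := contMDiff_const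
  have h4 := h1.comp ((contMDiff_equivTangentBundleProd_symm (n := ∞)).comp (h3.prodMk h2))
  refine h4.congr fun c => ?_
  have h5 := (hG (0, c)).mdifferentiableAt (by simp)
  have h6 : (mfderiv (𝓘(ℝ, ℝ).prod (𝓘(ℝ, EM).prod 𝓘(ℝ, F))) (𝓘(ℝ, EM).prod 𝓘(ℝ, F))
      (fun p : ℝ × TotalSpace F E => (⟨p.2.proj, p.2.2 + p.1 • W p.2⟩ : TotalSpace F E)) (0, c)
      ((1 : ℝ), (0 : EM × F)) : EM × F) = (show EM × F from verticalLift c (W c)) +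
      (show EM × F from mfderiv (𝓘(ℝ, EM).prod 𝓘(ℝ, F)) (𝓘(ℝ, EM).prod 𝓘(ℝ, F))
        (fun z : TotalSpace F E => (⟨z.proj, z.2 + (0 : ℝ) • W z⟩ : TotalSpace F E)) c 0) :=
    mfderiv_prod_eq_add_apply (v := ((1 : ℝ), (0 : EM × F))) h5
  rw [map_zero] at h6
  refine tangentBundle_mk_eq ?_ (h6.trans (add_zero _)).symm
  change c = ⟨c.proj, c.2 + (0 : ℝ) • W c⟩
  simp

end TotalSpaceGeometry

/-! ### Projectable sections through every vector -/

section ProjectableLift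

variable {EM : Type*} [NormedAddCommGroup EM] [NormedSpace ℝ EM]
  {M : Type*} [TopologicalSpace M] [ChartedSpace EM M] [IsManifold 𝓘(ℝ, EM) ∞ M]
  {F : Type*} [NormedAddCommGroup F] [NormedSpace ℝ F]
  {E : M → Type*} [TopologicalSpace (TotalSpace F E)] [∀ x, TopologicalSpace (E x)]
  [∀ x, AddCommGroup (E x)] [∀ x, Module ℝ (E x)] [FiberBundle F E] [VectorBundle ℝ F E]
  [ContMDiffVectorBundle ∞ F E 𝓘(ℝ, EM)]

theorem mdifferentiable_trivialization (e : Trivialization F (TotalSpace.proj : TotalSpace F E → M))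
    [MemTrivializationAtlas e] :
    e.toOpenPartialHomeomorph.MDifferentiable (𝓘(ℝ, EM).prod 𝓘(ℝ, F)) (𝓘(ℝ, EM).prod 𝓘(ℝ, F)) :=
  ⟨(e.contMDiffOn (n := ∞)).mdifferentiableOn (by simp),
    (e.contMDiffOn_symm (n := ∞)).mdifferentiableOn (by simp)⟩

/-- Over the base set of a trivialization, a vector field `X` on the base lifts to a smooth vector
field with prescribed value at a point. -/
theorem exists_local_lift (e : Trivialization F (TotalSpace.proj : TotalSpace F E → M))
    [MemTrivializationAtlas e] {X : ∀ x, TangentSpace 𝓘(ℝ, EM) x}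
    (hX : ContMDiff 𝓘(ℝ, EM) 𝓘(ℝ, EM).tangent ∞ (fun x => (⟨x, X x⟩ : TangentBundle 𝓘(ℝ, EM) M)))
    {a : TotalSpace F E} (ha : a.proj ∈ e.baseSet)
    {v : TangentSpace (𝓘(ℝ, EM).prod 𝓘(ℝ, F)) a}
    (hv : mfderiv (𝓘(ℝ, EM).prod 𝓘(ℝ, F)) 𝓘(ℝ, EM) (TotalSpace.proj : TotalSpace F E → M) a v =
      X a.proj) :
    ∃ U : ∀ c : TotalSpace F E, TangentSpace (𝓘(ℝ, EM).prod 𝓘(ℝ, F)) c,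
      ContMDiffOn (𝓘(ℝ, EM).prod 𝓘(ℝ, F)) (𝓘(ℝ, EM).prod 𝓘(ℝ, F)).tangent ∞
        (fun c => (⟨c, U c⟩ : TangentBundle (𝓘(ℝ, EM).prod 𝓘(ℝ, F)) (TotalSpace F E))) e.source ∧
      (∀ c ∈ e.source, mfderiv (𝓘(ℝ, EM).prod 𝓘(ℝ, F)) 𝓘(ℝ, EM)
        (TotalSpace.proj : TotalSpace F E → M) c (U c) = X c.proj) ∧ U a = v := by
  have he := mdifferentiable_trivialization (EM := EM) e
  have ha' : a ∈ e.source := e.mem_source.2 ha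
  -- In the trivialization the lift is `(X, f₀)` with constant fibre part; taking for `f₀` the fibre
  -- part of `v` gives the value `v` at `a`.
  let f₀ : F := (show EM × F from mfderiv (𝓘(ℝ, EM).prod 𝓘(ℝ, F)) (𝓘(ℝ, EM).prod 𝓘(ℝ, F)) e a v).2
  let U : ∀ c : TotalSpace F E, TangentSpace (𝓘(ℝ, EM).prod 𝓘(ℝ, F)) c := fun c =>
    mfderiv (𝓘(ℝ, EM).prod 𝓘(ℝ, F)) (𝓘(ℝ, EM).prod 𝓘(ℝ, F)) e.toOpenPartialHomeomorph.symm
      (e c) (show EM × F from (X c.proj, f₀))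
  have hproj : ∀ y ∈ e.target, ∀ w : EM × F,
      (mfderiv (𝓘(ℝ, EM).prod 𝓘(ℝ, F)) 𝓘(ℝ, EM) (TotalSpace.proj : TotalSpace F E → M)
        (e.toOpenPartialHomeomorph.symm y) (mfderiv (𝓘(ℝ, EM).prod 𝓘(ℝ, F))
          (𝓘(ℝ, EM).prod 𝓘(ℝ, F)) e.toOpenPartialHomeomorph.symm y w) : EM) = w.1 := by
    intro y hy w
    have h1 : (TotalSpace.proj : TotalSpace F E → M) ∘ e.toOpenPartialHomeomorph.symm =ᶠ[𝓝 y]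
        Prod.fst := by
      filter_upwards [e.open_target.mem_nhds hy] with z hz using e.proj_symm_apply hz
    have h2 := ((contMDiff_proj E (n := ∞) (IB := 𝓘(ℝ, EM)) (F := F)
      (e.toOpenPartialHomeomorph.symm y)).mdifferentiableAt (by simp)).hasMFDerivAt.comp y
        (he.mdifferentiableAt_symm hy).hasMFDerivAt
    have h3 := hasMFDerivAt_unique h2
      ((hasMFDerivAt_fst (I := 𝓘(ℝ, EM)) (I' := 𝓘(ℝ, F)) y).congr_of_eventuallyEq h1)
    exact congrArg (fun T : EM × F →L[ℝ] EM => T w) h3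
  refine ⟨U, ?_, fun c hc => ?_, ?_⟩
  · have h1 := (e.contMDiffOn_symm (n := ∞) (IB := 𝓘(ℝ, EM))).contMDiffOn_tangentMapWithin (m := ∞)
      (by simp) e.open_target.uniqueMDiffOn
    have h2 : ContMDiffOn (𝓘(ℝ, EM).prod 𝓘(ℝ, F)) 𝓘(ℝ, F).tangent ∞
        (fun c : TotalSpace F E => (⟨(e c).2, f₀⟩ : TangentBundle 𝓘(ℝ, F) F)) e.source :=
      ((contMDiff_vectorSpace_iff_contDiff (V := fun _ => f₀)).2 contDiff_const).comp_contMDiffOn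
        (contMDiff_snd.comp_contMDiffOn (e.contMDiffOn (n := ∞) (IB := 𝓘(ℝ, EM))))
    have h3 : ContMDiffOn (𝓘(ℝ, EM).prod 𝓘(ℝ, F)) 𝓘(ℝ, EM).tangent ∞
        (fun c : TotalSpace F E => (⟨c.proj, X c.proj⟩ : TangentBundle 𝓘(ℝ, EM) M)) e.source :=
      (hX.comp (contMDiff_proj E)).contMDiffOn
    have h4 := h1.comp ((contMDiff_equivTangentBundleProd_symm (n := ∞)).comp_contMDiffOn
      (h3.prodMk h2)) (fun c hc => by
        change ((c.proj, (e c).2) : M × F) ∈ e.target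
        rw [e.mk_proj_snd hc]
        exact e.map_source hc)
    refine h4.congr fun c hc => ?_
    have h5 : ((c.proj, (e c).2) : M × F) = e c := e.mk_proj_snd hc
    have h6 : e.toOpenPartialHomeomorph.symm (c.proj, (e c).2) = c := by
      rw [h5]
      exact e.left_inv hc
    refine tangentBundle_mk_eq h6.symm ?_
    have h7 : ∀ y : M × F, y = e c → ∀ w : EM × F,
        (mfderiv (𝓘(ℝ, EM).prod 𝓘(ℝ, F)) (𝓘(ℝ, EM).prod 𝓘(ℝ, F)) e.toOpenPartialHomeomorph.symm
          (e c) w : EM × F) = mfderivWithin (𝓘(ℝ, EM).prod 𝓘(ℝ, F)) (𝓘(ℝ, EM).prod 𝓘(ℝ, F))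
            e.toOpenPartialHomeomorph.symm e.target y w := by
      rintro _ rfl w
      exact congrArg (fun T : EM × F →L[ℝ] EM × F => T w)
        (mfderivWithin_of_isOpen e.open_target (e.map_source hc)).symm
    exact h7 _ h5 _
  · have h1 := hproj (e c) (e.map_source hc) (X c.proj, f₀)
    have h2 : ∀ c' : TotalSpace F E, c' = c → ∀ w : EM × F,
        (mfderiv (𝓘(ℝ, EM).prod 𝓘(ℝ, F)) 𝓘(ℝ, EM) (TotalSpace.proj : TotalSpace F E → M) c' w : EM) =
        mfderiv (𝓘(ℝ, EM).prod 𝓘(ℝ, F)) 𝓘(ℝ, EM) (TotalSpace.proj : TotalSpace F E → M) c w := by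
      rintro _ rfl w
      rfl
    exact (h2 _ (e.left_inv hc) _).symm.trans h1
  · have h1 : Prod.fst ∘ e =ᶠ[𝓝 a] (TotalSpace.proj : TotalSpace F E → M) := by
      filter_upwards [e.open_source.mem_nhds ha'] with z hz using e.coe_fst hz
    have h2 := (hasMFDerivAt_fst (I := 𝓘(ℝ, EM)) (I' := 𝓘(ℝ, F)) (e a)).comp a
      (he.mdifferentiableAt ha').hasMFDerivAt
    have h3 := hasMFDerivAt_unique (((contMDiff_proj E (n := ∞) (IB := 𝓘(ℝ, EM)) (F := F)
      a).mdifferentiableAt (by simp)).hasMFDerivAt) (h2.congr_of_eventuallyEq h1.symm)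
    have h4 : (X a.proj, f₀) = (show EM × F from
        mfderiv (𝓘(ℝ, EM).prod 𝓘(ℝ, F)) (𝓘(ℝ, EM).prod 𝓘(ℝ, F)) e a v) :=
      Prod.ext (hv.symm.trans (congrArg (fun T : EM × F →L[ℝ] EM => T v) h3)) rfl
    have h5 := congrArg (fun T : EM × F →L[ℝ] EM × F => T v) (he.symm_comp_deriv ha')
    exact (congrArg (fun w : EM × F => (mfderiv (𝓘(ℝ, EM).prod 𝓘(ℝ, F)) (𝓘(ℝ, EM).prod 𝓘(ℝ, F))
      e.toOpenPartialHomeomorph.symm (e a) w : EM × F)) h4).trans h5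

/-- There is a projectable section through every vector of the prolongation. -/
theorem LieAlgebroid.ProjectableSection.exists_eval_eq [FiniteDimensional ℝ EM] [T2Space M]
    [SigmaCompactSpace M] {A : LieAlgebroid EM F E} (a : TotalSpace F E) (z : A.prol a) :
    ∃ Z : A.ProjectableSection, Z.eval a = z := by
  obtain ⟨⟨b, v⟩, hz⟩ := z
  let e := trivializationAt F E a.proj
  have ha : a.proj ∈ e.baseSet := mem_baseSet_trivializationAt F E _
  obtain ⟨σ, hσ⟩ := exists_section (EM := EM) (F := F) a.proj b
  obtain ⟨U, hU, hUX, hUa⟩ := exists_local_lift e (A.contMDiff_anchor_section σ) ha (v := v)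
    (by rw [hσ]; exact Eq.symm hz)
  -- The trivialization covers whole fibres, so a cutoff on `M` is enough. Multiplying `σ` and `U`
  -- by the same function preserves the linear condition that defines the prolongation.
  obtain ⟨ψ, -, hψ⟩ := (SmoothBumpFunction.nhds_basis_tsupport (I := 𝓘(ℝ, EM)) a.proj).mem_iff.1
    (e.open_baseSet.mem_nhds ha)
  let f : C^∞⟮𝓘(ℝ, EM), M; ℝ⟯ := ⟨ψ, ψ.contMDiff⟩
  have hf : ContMDiff (𝓘(ℝ, EM).prod 𝓘(ℝ, F)) 𝓘(ℝ, ℝ) ∞ (fun c : TotalSpace F E => ψ c.proj) :=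
    ψ.contMDiff.comp (contMDiff_proj E)
  have hsupp : tsupport (fun c : TotalSpace F E => ψ c.proj) ⊆ e.source := fun c hc =>
    e.mem_source.2 (hψ (tsupport_comp_subset_preimage ψ (FiberBundle.continuous_proj F E) hc))
  have ha1 : ψ a.proj = 1 := ψ.eq_one
  refine ⟨⟨smulSection f σ, fun c => ψ c.proj • U c,
    ContMDiffOn.smul_section_of_tsupport hf.contMDiffOn e.open_source hsupp hU, fun c => ?_⟩, ?_⟩
  · change A.anchor c.proj (ψ c.proj • σ c.proj) = mfderiv (𝓘(ℝ, EM).prod 𝓘(ℝ, F)) 𝓘(ℝ, EM)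
      (TotalSpace.proj : TotalSpace F E → M) c (ψ c.proj • U c)
    rw [map_smul, map_smul]
    by_cases hc : c ∈ e.source
    · rw [hUX c hc]
    · have : ψ c.proj = 0 := image_eq_zero_of_notMem_tsupport fun h => hc (e.mem_source.2 (hψ h))
      rw [this, zero_smul, zero_smul]
  · refine Subtype.ext (Prod.ext ?_ ?_)
    · change ψ a.proj • σ a.proj = b
      rw [ha1, one_smul, hσ]
    · change ψ a.proj • U a = v
      rw [ha1, one_smul, hUa]

end ProjectableLift

/-! ### Cartan formulas in degree one, on `E` and on its prolongation -/

theorem cartanFormula_one {EM : Type*} [NormedAddCommGroup EM] [NormedSpace ℝ EM]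
    {HM : Type*} [TopologicalSpace HM] {I : ModelWithCorners ℝ EM HM}
    {M : Type*} [TopologicalSpace M] [ChartedSpace HM M]
    {V : M → Type*} [∀ x, AddCommGroup (V x)] [∀ x, Module ℝ (V x)] {S : Type*}
    {ρ : ∀ x : M, V x →ₗ[ℝ] TangentSpace I x} {ev : S → ∀ x, V x} {br : S → S → S}
    (θ : ∀ x, V x [⋀^Fin 1]→ₗ[ℝ] ℝ) (σ : Fin 2 → S) (x : M) :
    cartanFormula I ρ ev br θ σ x =
      mvfderiv I (fun y => θ y (fun _ => ev (σ 1) y)) x (ρ x (ev (σ 0) x))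
      - mvfderiv I (fun y => θ y (fun _ => ev (σ 0) y)) x (ρ x (ev (σ 1) x))
      - θ x (fun _ => ev (br (σ 0) (σ 1)) x) := by
  have h0 : ∀ l : Fin 1, Fin.succAbove (0 : Fin 2) l = 1 := by decide
  have h1 : ∀ l : Fin 1, Fin.succAbove (1 : Fin 2) l = 0 := by decide
  have h2 : (Matrix.vecCons (ev (br (σ 0) (σ 1)) x)
      (fun l : Fin 0 => ev (σ (Fin.succAbove (0 : Fin 2) (Fin.succAbove (0 : Fin 1) l))) x)) =
      fun _ => ev (br (σ 0) (σ 1)) x := by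
    funext l
    rw [Subsingleton.elim l 0]
    rfl
  -- The only pair of indices is `i = j = 0`; its sign `(-1) ^ (0 + 0 + 1)` is the minus before the
  -- bracket term.
  have h3 : Finset.Ici (0 : Fin 1) = {0} := by decide
  have h4 : cartanBracketTerm ev br θ σ x = - θ x (fun _ => ev (br (σ 0) (σ 1)) x) := by
    refine (Fin.sum_univ_one _).trans ?_
    rw [h3, Finset.sum_singleton, ← h2]
    simp
  rw [cartanFormula, h4, sub_eq_add_neg]
  congr 1
  refine (Fin.sum_univ_two _).trans ?_
  simp only [h0, h1]
  simp [sub_eq_add_neg]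

namespace LieAlgebroid

variable {EM : Type*} [NormedAddCommGroup EM] [NormedSpace ℝ EM]
  {M : Type*} [TopologicalSpace M] [ChartedSpace EM M] [IsManifold 𝓘(ℝ, EM) ∞ M]
  {F : Type*} [NormedAddCommGroup F] [NormedSpace ℝ F]
  {E : M → Type*} [TopologicalSpace (TotalSpace F E)] [∀ x, TopologicalSpace (E x)]
  [∀ x, AddCommGroup (E x)] [∀ x, Module ℝ (E x)] [FiberBundle F E] [VectorBundle ℝ F E]
  [ContMDiffVectorBundle ∞ F E 𝓘(ℝ, EM)]

theorem _root_.LieAlgd.isSmoothCovectorFamily_id {α : ∀ x : M, E x →ₗ[ℝ] ℝ}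
    (hα : ContMDiff (𝓘(ℝ, EM).prod 𝓘(ℝ, F)) 𝓘(ℝ, ℝ) ∞ (fun c : TotalSpace F E => α c.proj c.2)) :
    IsSmoothCovectorFamily EM F (ϕ := fun x : M => x) 𝓘(ℝ, EM) α :=
  fun σ => hα.comp σ.contMDiff

/-- The Cartan formula for the exterior differential of a `1`-form. -/
theorem d_one_apply [FiniteDimensional ℝ EM] [T2Space M] [SigmaCompactSpace M]
    [FiniteDimensional ℝ F] (A : LieAlgebroid EM F E) {α : ∀ x : M, E x →ₗ[ℝ] ℝ}
    (hα : IsSmoothCovectorFamily EM F (ϕ := fun x : M => x) 𝓘(ℝ, EM) α)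
    (σ η : Cₛ^∞⟮𝓘(ℝ, EM); F, E⟯) (x : M) :
    A.d (fun x => AlternatingMap.ofSubsingleton ℝ (E x) ℝ (0 : Fin 1) (α x)) x ![σ x, η x] =
      hα.derivPairing x η (A.anchor x (σ x)) - hα.derivPairing x σ (A.anchor x (η x))
        - α x (A.bracket σ η x) := by
  -- Here `ϕ` is the identity. The form produced has the values of the Cartan formula, so
  -- `extDifferential` is this form and not its default value `0`.
  have hex := fun x : M => hα.exists_differential A (n := x) mdifferentiableAt_id
    LinearMap.id (A.anchor x) (fun z => by
      have := mfderiv_id (I := 𝓘(ℝ, EM)) (x := x)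
      exact (congrArg (fun T : EM →L[ℝ] EM => T (A.anchor x z)) this).symm)
  choose Ω hΩ using hex
  have h : A.d (fun x => AlternatingMap.ofSubsingleton ℝ (E x) ℝ (0 : Fin 1) (α x)) = Ω := by
    apply extDifferential_eq
    · exact fun x v => exists_section x v
    · intro s y
      rw [hΩ y _ (s 0) (s 1) rfl rfl, cartanFormula_one]
      rfl
  rw [h]
  exact hΩ x _ σ η rfl rfl

/-- The fibre derivative of a function on `E`. -/
def _root_.LieAlgd.fiberDeriv (L : TotalSpace F E → ℝ) (c : TotalSpace F E) : E c.proj →ₗ[ℝ] ℝ :=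
  (mvfderiv (𝓘(ℝ, EM).prod 𝓘(ℝ, F)) L c).toLinearMap ∘ₗ verticalLiftₗ c

/-- The pairing with `σ` is the derivative of `L` along the vertical lift of `σ ∘ τ`. Since `θ_L (b,
v)` is the fibre derivative applied to `b`, this presents `θ_L` as a covector family along `τ`. -/
theorem _root_.LieAlgd.isSmoothCovectorFamily_fiberDeriv {L : TotalSpace F E → ℝ}
    (hL : ContMDiff (𝓘(ℝ, EM).prod 𝓘(ℝ, F)) 𝓘(ℝ, ℝ) ∞ L) :
    IsSmoothCovectorFamily EM F (ϕ := TotalSpace.proj) (𝓘(ℝ, EM).prod 𝓘(ℝ, F))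
      (fiberDeriv (EM := EM) L) :=
  fun σ => contMDiff_mvfderiv_apply hL
    (contMDiff_verticalLift (W := fun c => σ c.proj) (σ.contMDiff.comp (contMDiff_proj E)))

variable [FiniteDimensional ℝ EM] [T2Space M] [SigmaCompactSpace M] [FiniteDimensional ℝ F]

/-- The energy of a smooth Lagrangian is smooth. -/
theorem contMDiff_energy (A : LieAlgebroid EM F E) {L : TotalSpace F E → ℝ}
    (hL : ContMDiff (𝓘(ℝ, EM).prod 𝓘(ℝ, F)) 𝓘(ℝ, ℝ) ∞ L) :
    ContMDiff (𝓘(ℝ, EM).prod 𝓘(ℝ, F)) 𝓘(ℝ, ℝ) ∞ (A.energy L) :=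
  (contMDiff_mvfderiv_apply hL
    (contMDiff_verticalLift (W := fun c : TotalSpace F E => c.2) contMDiff_id)).sub hL

/-- The Cartan formula for the Cartan `2`-section. -/
theorem cartanTwo_apply (A : LieAlgebroid EM F E) {L : TotalSpace F E → ℝ}
    (hL : ContMDiff (𝓘(ℝ, EM).prod 𝓘(ℝ, F)) 𝓘(ℝ, ℝ) ∞ L) {a : TotalSpace F E} (z w : A.prol a)
    {σ η : Cₛ^∞⟮𝓘(ℝ, EM); F, E⟯} (hσ : σ a.proj = z.1.1) (hη : η a.proj = w.1.1) :
    A.cartanTwo L a ![z, w] = -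
      ((isSmoothCovectorFamily_fiberDeriv hL).derivPairing a η z.1.2
        - (isSmoothCovectorFamily_fiberDeriv hL).derivPairing a σ w.1.2
        - fiberDeriv (EM := EM) L a (A.bracket σ η a.proj)) := by
  -- Here `ϕ` is the projection `τ`. On projectable sections the form agrees with the Cartan formula
  -- for `θ_L`; afterwards only sections of `E` are needed, with no vector fields on the total
  -- space.
  have hex := fun a : TotalSpace F E =>
    (isSmoothCovectorFamily_fiberDeriv (EM := EM) hL).exists_differential A (n := a)
      ((contMDiff_proj E (n := ∞) a).mdifferentiableAt (by simp))
      (LinearMap.fst ℝ _ _ ∘ₗ (A.prol a).subtype) (A.prolAnchor a) (fun z => z.2)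
  choose Ω hΩ using hex
  have h : A.prolD (A.cartanOne L) = Ω := by
    apply extDifferential_eq
    · exact fun a z => ProjectableSection.exists_eval_eq a z
    · intro s y
      rw [hΩ y _ (s 0).base (s 1).base rfl rfl, cartanFormula_one]
      rfl
  rw [cartanTwo, h, AlternatingMap.neg_apply, hΩ a ![z, w] σ η hσ hη]
  rfl

end LieAlgebroid

/-! ### One-forms through a covector and pairings vanishing to second order -/

section Pairing

variable {EM : Type*} [NormedAddCommGroup EM] [NormedSpace ℝ EM] [FiniteDimensional ℝ EM]
  {M : Type*} [TopologicalSpace M] [T2Space M] [ChartedSpace EM M] [IsManifold 𝓘(ℝ, EM) ∞ M]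
  {F : Type*} [NormedAddCommGroup F] [NormedSpace ℝ F] [FiniteDimensional ℝ F]
  {E : M → Type*} [TopologicalSpace (TotalSpace F E)] [∀ x, TopologicalSpace (E x)]
  [∀ x, AddCommGroup (E x)] [∀ x, Module ℝ (E x)] [FiberBundle F E] [VectorBundle ℝ F E]
  [ContMDiffVectorBundle ∞ F E 𝓘(ℝ, EM)]

/-- There is a smooth `1`-form through every covector. -/
theorem exists_oneForm (x : M) (ℓ : E x →ₗ[ℝ] ℝ) :
    ∃ α : ∀ y, E y →ₗ[ℝ] ℝ, ContMDiff (𝓘(ℝ, EM).prod 𝓘(ℝ, F)) 𝓘(ℝ, ℝ) ∞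
      (fun c : TotalSpace F E => α c.proj c.2) ∧ α x = ℓ := by
  obtain ⟨r, e, κ, hκ, hfr⟩ := exists_frame (F := F) (E := E) (EM := EM) x
  refine ⟨fun y => ∑ i, ℓ (e i x) • κ i y, ?_, ?_⟩
  · simp only [LinearMap.sum_apply, LinearMap.smul_apply, smul_eq_mul]
    exact contMDiff_finsetSum fun i _ => contMDiff_const.mul (hκ i)
  · ext w
    conv_rhs => rw [hfr.self_of_nhds w]
    simp [mul_comm]

variable {EN : Type*} [NormedAddCommGroup EN] [NormedSpace ℝ EN]
  {HN : Type*} [TopologicalSpace HN] {J : ModelWithCorners ℝ EN HN}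
  {N : Type*} [TopologicalSpace N] [ChartedSpace HN N]

/-- The derivative of the pairing of a smooth covector family and a smooth vector family vanishes
where both vanish. -/
theorem IsSmoothCovectorFamily.mvfderiv_pairing_eq_zero {ψ : N → M} {β : ∀ n, E (ψ n) →ₗ[ℝ] ℝ}
    (hβ : IsSmoothCovectorFamily EM F J β) {ξ₁ ξ₂ : ∀ n, E (ψ n)}
    (h₁ : ContMDiff J (𝓘(ℝ, EM).prod 𝓘(ℝ, F)) ∞ (fun n => (⟨ψ n, ξ₁ n⟩ : TotalSpace F E)))
    (h₂ : ContMDiff J (𝓘(ℝ, EM).prod 𝓘(ℝ, F)) ∞ (fun n => (⟨ψ n, ξ₂ n⟩ : TotalSpace F E)))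
    {n₀ : N} (hβ₀ : β n₀ = 0) (hξ₀ : ξ₁ n₀ = ξ₂ n₀) :
    mvfderiv J (fun n => β n (ξ₁ n - ξ₂ n)) n₀ = 0 := by
  obtain ⟨r, e, κ, hκ, hfr⟩ := exists_frame (F := F) (E := E) (EM := EM) (ψ n₀)
  have hψ : Continuous ψ := (FiberBundle.continuous_proj F E).comp h₁.continuous
  have hk : ∀ i, MDifferentiableAt J 𝓘(ℝ, ℝ) (fun n => κ i (ψ n) (ξ₁ n - ξ₂ n)) n₀ := by
    intro i
    have := ((hκ i).comp h₁).sub ((hκ i).comp h₂)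
    refine MDifferentiableAt.congr_of_eventuallyEq ((this n₀).mdifferentiableAt (by simp))
      (Filter.Eventually.of_forall fun n => map_sub _ _ _)
  -- Smoothness of `β` is known only against global sections, hence the expansion in a frame. Each
  -- summand is a product of two functions that vanish at `n₀`.
  have hev : (fun n => β n (ξ₁ n - ξ₂ n)) =ᶠ[𝓝 n₀]
      ∑ i, (fun n => κ i (ψ n) (ξ₁ n - ξ₂ n)) * fun n => β n (e i (ψ n)) := by
    filter_upwards [hψ.continuousAt.eventually hfr] with n hn
    conv_lhs => rw [hn (ξ₁ n - ξ₂ n)]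
    simp only [map_sum, Finset.sum_apply, Pi.mul_apply, map_smul, smul_eq_mul]
  have hd : mvfderiv J (fun n => β n (ξ₁ n - ξ₂ n)) n₀ =
      mvfderiv J (∑ i, (fun n => κ i (ψ n) (ξ₁ n - ξ₂ n)) * fun n => β n (e i (ψ n))) n₀ := by
    ext v
    exact congrArg (fun T : EN →L[ℝ] ℝ => T v) hev.mfderiv_eq
  rw [hd]
  refine (Finset.sum_induction _ (fun f : N → ℝ => MDifferentiableAt J 𝓘(ℝ, ℝ) f n₀ ∧
    mvfderiv J f n₀ = 0) ?_ ?_ fun i _ => ?_).2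
  · rintro f g ⟨hf, hf'⟩ ⟨hg, hg'⟩
    exact ⟨hf.add hg, by rw [mvfderiv_add hf hg, hf', hg', add_zero]⟩
  · exact ⟨mdifferentiableAt_const, mvfderiv_zero⟩
  · refine ⟨(hk i).mul (hβ.mdifferentiableAt (e i) n₀), ?_⟩
    rw [mvfderiv_mul (hk i) (hβ.mdifferentiableAt (e i) n₀), hβ₀, hξ₀]
    simp

end Pairing

/-! ### Prolonged morphisms and the pullback of the Lagrangian data -/

section Morphisms

variable {EM : Type*} [NormedAddCommGroup EM] [NormedSpace ℝ EM]
  {M : Type*} [TopologicalSpace M] [ChartedSpace EM M] [IsManifold 𝓘(ℝ, EM) ∞ M]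
  {F : Type*} [NormedAddCommGroup F] [NormedSpace ℝ F]
  {E : M → Type*} [TopologicalSpace (TotalSpace F E)] [∀ x, TopologicalSpace (E x)]
  [∀ x, AddCommGroup (E x)] [∀ x, Module ℝ (E x)] [FiberBundle F E] [VectorBundle ℝ F E]
  [ContMDiffVectorBundle ∞ F E 𝓘(ℝ, EM)]
  {EM' : Type*} [NormedAddCommGroup EM'] [NormedSpace ℝ EM']
  {M' : Type*} [TopologicalSpace M'] [ChartedSpace EM' M'] [IsManifold 𝓘(ℝ, EM') ∞ M']
  {F' : Type*} [NormedAddCommGroup F'] [NormedSpace ℝ F']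
  {E' : M' → Type*} [TopologicalSpace (TotalSpace F' E')] [∀ x, TopologicalSpace (E' x)]
  [∀ x, AddCommGroup (E' x)] [∀ x, Module ℝ (E' x)] [FiberBundle F' E'] [VectorBundle ℝ F' E']
  [ContMDiffVectorBundle ∞ F' E' 𝓘(ℝ, EM')]

namespace VBMap

variable (Φ : VBMap EM F E EM' F' E')

theorem mdifferentiableAt_total (a : TotalSpace F E) :
    MDifferentiableAt (𝓘(ℝ, EM).prod 𝓘(ℝ, F)) (𝓘(ℝ, EM').prod 𝓘(ℝ, F')) Φ.total a :=
  (Φ.contMDiff_total a).mdifferentiableAt (by simp)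

/-- The tangent map of a vector bundle map sends vertical lifts to vertical lifts. -/
theorem mfderiv_total_verticalLift (a : TotalSpace F E) (b : E a.proj) :
    mfderiv (𝓘(ℝ, EM).prod 𝓘(ℝ, F)) (𝓘(ℝ, EM').prod 𝓘(ℝ, F')) Φ.total a (verticalLift a b) =
      verticalLift (Φ.total a) (Φ.fiber a.proj b) := by
  have h0 : (fun t : ℝ => (⟨a.proj, a.2 + t • b⟩ : TotalSpace F E)) 0 = a := by simp
  have h1 := ((contMDiff_verticalCurve (EM := EM) a b) 0).mdifferentiableAt (by simp)
  have h2 := (Φ.mdifferentiableAt_total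
    ((fun t : ℝ => (⟨a.proj, a.2 + t • b⟩ : TotalSpace F E)) 0)).hasMFDerivAt.comp (0 : ℝ)
      h1.hasMFDerivAt
  have h3 : Φ.total ∘ (fun t : ℝ => (⟨a.proj, a.2 + t • b⟩ : TotalSpace F E)) =
      fun t : ℝ => (⟨(Φ.total a).proj,
        (Φ.total a).2 + t • (show E' (Φ.total a).proj from Φ.fiber a.proj b)⟩ : TotalSpace F' E') := by
    funext t
    change (⟨Φ.base a.proj, Φ.fiber a.proj (a.2 + t • b)⟩ : TotalSpace F' E') =
      ⟨Φ.base a.proj, Φ.fiber a.proj a.2 + t • Φ.fiber a.proj b⟩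
    rw [map_add, map_smul]
  have h4 := h2.mfderiv
  rw [h0, h3] at h4
  exact (congrArg (fun T : ℝ →L[ℝ] EM' × F' => T 1) h4).symm

variable {Φ}

theorem mvfderiv_eq_of_comp_total {L : TotalSpace F E → ℝ} {L' : TotalSpace F' E' → ℝ}
    (hL' : ContMDiff (𝓘(ℝ, EM').prod 𝓘(ℝ, F')) 𝓘(ℝ, ℝ) ∞ L') (h : ∀ a, L a = L' (Φ.total a))
    (a : TotalSpace F E) (v : TangentSpace (𝓘(ℝ, EM).prod 𝓘(ℝ, F)) a) :
    mvfderiv (𝓘(ℝ, EM).prod 𝓘(ℝ, F)) L a v =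
      mvfderiv (𝓘(ℝ, EM').prod 𝓘(ℝ, F')) L' (Φ.total a)
        (mfderiv (𝓘(ℝ, EM).prod 𝓘(ℝ, F)) (𝓘(ℝ, EM').prod 𝓘(ℝ, F')) Φ.total a v) := by
  have : L = L' ∘ Φ.total := funext h
  rw [this]
  exact mvfderiv_comp_apply a ((hL' _).mdifferentiableAt (by simp)) (Φ.mdifferentiableAt_total a) v

/-- By linearity on fibres, `TΦ` maps the vertical lift of `b` to that of `Φ(b)`; the rest is the
chain rule. This is the pointwise form of `T^* θ_{L'} = θ_L`. -/
theorem fiberDeriv_eq {L : TotalSpace F E → ℝ} {L' : TotalSpace F' E' → ℝ}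
    (hL' : ContMDiff (𝓘(ℝ, EM').prod 𝓘(ℝ, F')) 𝓘(ℝ, ℝ) ∞ L') (h : ∀ a, L a = L' (Φ.total a))
    (a : TotalSpace F E) (b : E a.proj) :
    fiberDeriv (EM := EM) L a b =
      fiberDeriv (EM := EM') L' (Φ.total a) (Φ.fiber a.proj b) := by
  refine (mvfderiv_eq_of_comp_total hL' h a (verticalLift a b)).trans ?_
  rw [mfderiv_total_verticalLift]
  rfl

variable {A : LieAlgebroid EM F E} {A' : LieAlgebroid EM' F' E'}

/-- The term `dL(Δ)` at `a` is the fibre derivative paired with `a` itself, so this is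
`fiberDeriv_eq` at `b = a`. -/
theorem energy_eq_energy_total {L : TotalSpace F E → ℝ} {L' : TotalSpace F' E' → ℝ}
    (hL' : ContMDiff (𝓘(ℝ, EM').prod 𝓘(ℝ, F')) 𝓘(ℝ, ℝ) ∞ L') (h : ∀ a, L a = L' (Φ.total a))
    (a : TotalSpace F E) : A.energy L a = A'.energy L' (Φ.total a) := by
  have := fiberDeriv_eq hL' h a a.2
  exact congrArg₂ (· - ·) this (h a)

variable [FiniteDimensional ℝ EM] [T2Space M] [SigmaCompactSpace M] [FiniteDimensional ℝ F]
  [FiniteDimensional ℝ EM'] [T2Space M'] [SigmaCompactSpace M'] [FiniteDimensional ℝ F']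

/-- The prolongation of a fibrewise surjective morphism is fibrewise surjective. -/
theorem prolong_surjective (h : Φ.IsAdmissible A A') (hs : Φ.IsFiberwiseSurjective)
    (a : TotalSpace F E) : Function.Surjective (Φ.prolong h a) := by
  rintro ⟨⟨b', v'⟩, hz'⟩
  obtain ⟨b, hb⟩ := hs a.proj b'
  obtain ⟨v, hv⟩ := mfderiv_proj_surjective (F := F) a (A.anchor a.proj b)
  let z : A.prol a := ⟨(b, v), hv.symm⟩
  have h1 := (Φ.prolong h a z).2
  let v'' : TangentSpace (𝓘(ℝ, EM').prod 𝓘(ℝ, F')) (Φ.total a) :=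
    mfderiv (𝓘(ℝ, EM).prod 𝓘(ℝ, F)) (𝓘(ℝ, EM').prod 𝓘(ℝ, F')) Φ.total a v
  have h1' : A'.anchor (Φ.base a.proj) (Φ.fiber a.proj b) = mfderiv (𝓘(ℝ, EM').prod 𝓘(ℝ, F'))
    𝓘(ℝ, EM') (TotalSpace.proj : TotalSpace F' E' → M') (Φ.total a) v'' := h1
  have hz'' : A'.anchor (Φ.base a.proj) b' = mfderiv (𝓘(ℝ, EM').prod 𝓘(ℝ, F'))
    𝓘(ℝ, EM') (TotalSpace.proj : TotalSpace F' E' → M') (Φ.total a) v' := hz'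
  -- By admissibility `v'` and `TΦ(v)` have the same projection, so they differ by a vertical lift,
  -- and its argument `c'` lifts to `E`. The base map need not be a submersion.
  obtain ⟨c', hc'⟩ := exists_verticalLift_eq_of_mfderiv_proj_eq_zero (a := Φ.total a)
    (v := v' - v'') (by
      rw [map_sub, ← h1', ← hz'', hb]
      exact sub_self _)
  obtain ⟨c, hc⟩ := hs a.proj c'
  have hv2 : mfderiv (𝓘(ℝ, EM).prod 𝓘(ℝ, F)) 𝓘(ℝ, EM) (TotalSpace.proj : TotalSpace F E → M) a
      (v + verticalLift a c) = A.anchor a.proj b := by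
    rw [map_add, hv, mfderiv_proj_verticalLift, add_zero]
  refine ⟨⟨(b, v + verticalLift a c), hv2.symm⟩, Subtype.ext (Prod.ext hb ?_)⟩
  change mfderiv (𝓘(ℝ, EM).prod 𝓘(ℝ, F)) (𝓘(ℝ, EM').prod 𝓘(ℝ, F')) Φ.total a
    (v + verticalLift a c) = v'
  rw [map_add, mfderiv_total_verticalLift, hc, hc']
  change v'' + (v' - v'') = v'
  abel

/-- The differential of the energy is preserved by the prolongation. -/
theorem prolDFun_energy_eq (hA : Φ.IsAdmissible A A') {L : TotalSpace F E → ℝ}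
    {L' : TotalSpace F' E' → ℝ} (hL' : ContMDiff (𝓘(ℝ, EM').prod 𝓘(ℝ, F')) 𝓘(ℝ, ℝ) ∞ L')
    (h : ∀ a, L a = L' (Φ.total a)) (a : TotalSpace F E) (w : A.prol a) :
    A.prolDFun (A.energy L) a w = A'.prolDFun (A'.energy L') (Φ.total a) (Φ.prolong hA a w) :=
  mvfderiv_eq_of_comp_total (A'.contMDiff_energy hL') (energy_eq_energy_total hL' h) a w.1.2

/-- The pullback formula `Φ^⋆ dα = d Φ^⋆ α` for a `1`-form, in terms of sections. -/
theorem IsMorphism.cartanFormula_one_eq (hΦ : Φ.IsMorphism A A') {α : ∀ x, E' x →ₗ[ℝ] ℝ}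
    (hα : IsSmoothCovectorFamily EM' F' (ϕ := fun x : M' => x) 𝓘(ℝ, EM') α)
    (hα' : IsSmoothCovectorFamily EM F (ϕ := fun x : M => x) 𝓘(ℝ, EM)
      fun x => α (Φ.base x) ∘ₗ Φ.fiber x)
    (x : M) {σ η : Cₛ^∞⟮𝓘(ℝ, EM); F, E⟯} {σ' η' : Cₛ^∞⟮𝓘(ℝ, EM'); F', E'⟯}
    (hσ : Φ.fiber x (σ x) = σ' (Φ.base x)) (hη : Φ.fiber x (η x) = η' (Φ.base x)) :
    hα.derivPairing (Φ.base x) η' (A'.anchor _ (σ' (Φ.base x)))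
      - hα.derivPairing (Φ.base x) σ' (A'.anchor _ (η' (Φ.base x)))
      - α (Φ.base x) (A'.bracket σ' η' (Φ.base x)) =
    hα'.derivPairing x η (A.anchor x (σ x)) - hα'.derivPairing x σ (A.anchor x (η x))
      - α (Φ.base x) (Φ.fiber x (A.bracket σ η x)) := by
  -- The sections `σ'`, `η'` match `σ`, `η` only at `x`. That is enough, since each side of the
  -- Cartan formula depends only on values at the point.
  have h := hΦ 1 (fun x => AlternatingMap.ofSubsingleton ℝ (E' x) ℝ (0 : Fin 1) (α x))
    (fun σ => hα (σ 0))
  have h1 : Φ.pullback (fun x => AlternatingMap.ofSubsingleton ℝ (E' x) ℝ (0 : Fin 1) (α x)) =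
      fun x => AlternatingMap.ofSubsingleton ℝ (E x) ℝ (0 : Fin 1)
        (α (Φ.base x) ∘ₗ Φ.fiber x) := rfl
  rw [h1] at h
  have h2 := congrArg (fun θ => θ ![σ x, η x]) (congrFun h x)
  have h3 := A.d_one_apply hα' σ η x
  have h4 := A'.d_one_apply hα σ' η' (Φ.base x)
  have h5 : (fun i => Φ.fiber x ((![σ x, η x] : Fin 2 → E x) i)) =
      ![σ' (Φ.base x), η' (Φ.base x)] := by
    funext i
    fin_cases i
    exacts [hσ, hη]
  rw [← h5] at h4
  exact (h4.symm.trans h2).trans h3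

/-- The prolongation of a morphism pulls `ω_{L'}` back to `ω_L`, if `L = L' ∘ Φ`. -/
theorem IsMorphism.cartanTwo_eq (hΦ : Φ.IsMorphism A A') (hA : Φ.IsAdmissible A A')
    {L : TotalSpace F E → ℝ} {L' : TotalSpace F' E' → ℝ}
    (hL : ContMDiff (𝓘(ℝ, EM).prod 𝓘(ℝ, F)) 𝓘(ℝ, ℝ) ∞ L)
    (hL' : ContMDiff (𝓘(ℝ, EM').prod 𝓘(ℝ, F')) 𝓘(ℝ, ℝ) ∞ L')
    (h : ∀ a, L a = L' (Φ.total a)) (a : TotalSpace F E) (z w : A.prol a) :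
    A.cartanTwo L a ![z, w] =
      A'.cartanTwo L' (Φ.total a) ![Φ.prolong hA a z, Φ.prolong hA a w] := by
  obtain ⟨σ, hσ⟩ := exists_section (EM := EM) (F := F) a.proj z.1.1
  obtain ⟨η, hη⟩ := exists_section (EM := EM) (F := F) a.proj w.1.1
  obtain ⟨σ', hσ'⟩ := exists_section (EM := EM') (F := F') (Φ.base a.proj) (Φ.fiber a.proj z.1.1)
  obtain ⟨η', hη'⟩ := exists_section (EM := EM') (F := F') (Φ.base a.proj) (Φ.fiber a.proj w.1.1)
  -- The fibre derivatives of `L'` vary within a fibre and so are not a `1`-form on `E'`; `α`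
  -- matches them at the single point `Φ(a)`.
  obtain ⟨α, hα, hαa⟩ := exists_oneForm (EM := EM') (F := F') (Φ.base a.proj)
    (fiberDeriv (EM := EM') L' (Φ.total a))
  have hα₁ := isSmoothCovectorFamily_id (EM := EM') hα
  have hα₂ : IsSmoothCovectorFamily EM F (ϕ := fun x : M => x) 𝓘(ℝ, EM)
      fun x => α (Φ.base x) ∘ₗ Φ.fiber x :=
    isSmoothCovectorFamily_id (hα.comp Φ.contMDiff_total)
  have hF := isSmoothCovectorFamily_fiberDeriv (EM := EM) hL
  have hF' := isSmoothCovectorFamily_fiberDeriv (EM := EM') hL'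
  -- The discrepancy between differentiating the fibre derivatives and differentiating `α` is the
  -- same on `E` as on `E'`. The reason is that `β` and `Φ ∘ η - η' ∘ φ`, taken along `φ ∘ τ`, both
  -- vanish at `a`.
  have key : ∀ (z : A.prol a) (η : Cₛ^∞⟮𝓘(ℝ, EM); F, E⟯) (η' : Cₛ^∞⟮𝓘(ℝ, EM'); F', E'⟯),
      Φ.fiber a.proj (η a.proj) = η' (Φ.base a.proj) →
      hF.derivPairing a η z.1.2 - hα₂.derivPairing a.proj η (A.anchor a.proj z.1.1) =
        hF'.derivPairing (Φ.total a) η' (Φ.prolong hA a z).1.2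
          - hα₁.derivPairing (Φ.base a.proj) η' (A'.anchor _ (Φ.fiber a.proj z.1.1)) := by
    intro z η η' hηη'
    have top : (∞ : ℕ∞ω) ≠ 0 := by simp
    have hp : ContMDiff (𝓘(ℝ, EM).prod 𝓘(ℝ, F)) 𝓘(ℝ, EM') ∞
        (fun c : TotalSpace F E => Φ.base c.proj) := Φ.contMDiff_base.comp (contMDiff_proj E)
    let β : ∀ c : TotalSpace F E, E' (Φ.base c.proj) →ₗ[ℝ] ℝ := fun c =>
      (show E' (Φ.base c.proj) →ₗ[ℝ] ℝ from fiberDeriv (EM := EM') L' (Φ.total c))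
        - α (Φ.base c.proj)
    have hβ : IsSmoothCovectorFamily EM' F' (𝓘(ℝ, EM).prod 𝓘(ℝ, F)) β := fun s =>
      ((hF' s).comp Φ.contMDiff_total).sub ((hα.comp s.contMDiff).comp hp)
    have h0 := hβ.mvfderiv_pairing_eq_zero (n₀ := a)
      (ξ₁ := fun c => Φ.fiber c.proj (η c.proj)) (ξ₂ := fun c => η' (Φ.base c.proj))
      (Φ.contMDiff_total.comp (η.contMDiff.comp (contMDiff_proj E))) (η'.contMDiff.comp hp)
      (sub_eq_zero.2 hαa.symm) hηη'
    have hproj : MDifferentiableAt (𝓘(ℝ, EM).prod 𝓘(ℝ, F)) 𝓘(ℝ, EM)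
      (TotalSpace.proj : TotalSpace F E → M) a :=
      (contMDiff_proj E (n := ∞) a).mdifferentiableAt top
    have hproj' : MDifferentiableAt (𝓘(ℝ, EM').prod 𝓘(ℝ, F')) 𝓘(ℝ, EM')
      (TotalSpace.proj : TotalSpace F' E' → M') (Φ.total a) :=
      (contMDiff_proj E' (n := ∞) (Φ.total a)).mdifferentiableAt top
    have d1 := hF.mdifferentiableAt η a
    have d2 := hα₂.mdifferentiableAt η a.proj
    have d3 := hF'.mdifferentiableAt η' (Φ.total a)
    have d4 := hα₁.mdifferentiableAt η' (Φ.base a.proj)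
    have d4' := d4.comp (Φ.total a) hproj'
    have d2c := d2.comp a hproj
    have d3c := d3.comp a (Φ.mdifferentiableAt_total a)
    have d4c := d4'.comp a (Φ.mdifferentiableAt_total a)
    -- Expanding the pairing gives four functions on `E`; the fibre derivative of `L'` on `Φ(η)`
    -- becomes that of `L` on `η`.
    have hfun : (fun c : TotalSpace F E => β c (Φ.fiber c.proj (η c.proj) - η' (Φ.base c.proj))) =
        ((fun c => fiberDeriv (EM := EM) L c (η c.proj))
          - (fun x => (α (Φ.base x) ∘ₗ Φ.fiber x) (η x)) ∘ TotalSpace.proj)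
        - ((fun c' => fiberDeriv (EM := EM') L' c' (η' c'.proj)) ∘ Φ.total
          - ((fun x' => α x' (η' x')) ∘ TotalSpace.proj) ∘ Φ.total) := by
      funext c
      have := fiberDeriv_eq hL' h c (η c.proj)
      have arith : ∀ {p p' q r s : ℝ}, p' = p → p - q - (r - s) = p' - q - (r - s) := by
        rintro p _ q r s rfl
        rfl
      exact (map_sub (β c) _ _).trans (arith this)
    rw [hfun, mvfderiv_sub (d1.sub d2c) (d3c.sub d4c), mvfderiv_sub d1 d2c,
      mvfderiv_sub d3c d4c] at h0
    have h1 := congrArg (fun T => T z.1.2) (sub_eq_zero.1 h0)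
    have hz : A.anchor a.proj z.1.1 = mfderiv (𝓘(ℝ, EM).prod 𝓘(ℝ, F)) 𝓘(ℝ, EM)
      (TotalSpace.proj : TotalSpace F E → M) a z.1.2 := z.2
    have hz' : A'.anchor (Φ.base a.proj) (Φ.fiber a.proj z.1.1) =
      mfderiv (𝓘(ℝ, EM').prod 𝓘(ℝ, F')) 𝓘(ℝ, EM') (TotalSpace.proj : TotalSpace F' E' → M')
        (Φ.total a) (Φ.prolong hA a z).1.2 := (Φ.prolong hA a z).2
    -- The `α`-terms factor through the projections, so the tangent component enters them only
    -- through the anchor.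
    have c2 := (congrArg (hα₂.derivPairing a.proj η) hz).trans
      (mvfderiv_comp_apply a d2 hproj z.1.2).symm
    have c3 := mvfderiv_comp_apply a d3 (Φ.mdifferentiableAt_total a) z.1.2
    have c4 := (congrArg (hα₁.derivPairing (Φ.base a.proj) η') hz').trans
      ((mvfderiv_comp_apply (Φ.total a) d4 hproj' (Φ.prolong hA a z).1.2).symm.trans
        (mvfderiv_comp_apply a d4' (Φ.mdifferentiableAt_total a) z.1.2).symm)
    rw [c2, c4]
    exact h1.trans (congrArg (fun t : ℝ => t - _) c3)
  rw [A.cartanTwo_apply hL z w hσ hη,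
    A'.cartanTwo_apply hL' (Φ.prolong hA a z) (Φ.prolong hA a w) hσ' hη']
  have e1 := key z η η' (by rw [hη, hη'])
  have e2 := key w σ σ' (by rw [hσ, hσ'])
  have e3 := hΦ.cartanFormula_one_eq hα₁ hα₂ a.proj (σ := σ) (η := η) (σ' := σ') (η' := η')
    (by rw [hσ, hσ']) (by rw [hη, hη'])
  rw [hσ, hη, hσ', hη', hαa] at e3
  have e4 := fiberDeriv_eq hL' h a (A.bracket σ η a.proj)
  -- `x`, `y` are the derivatives of the fibre-derivative and `α` pairings on `E`, and `p`, `q`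
  -- those on `E'`. The morphism identity for `α` absorbs the mismatch of the brackets.
  have arith : ∀ {x₁ x₂ y₁ y₂ p₁ p₂ q₁ q₂ b b' c : ℝ}, x₁ - y₁ = p₁ - q₁ → x₂ - y₂ = p₂ - q₂ →
      q₁ - q₂ - b' = y₁ - y₂ - c → b = c → -(x₁ - x₂ - b) = -(p₁ - p₂ - b') := by
    intros
    linarith
  exact arith e1 e2 e3 e4

/-- At the points of `Φ(E)`, regularity passes from `L = L' ∘ Φ` to `L'`. -/
theorem IsMorphism.isRegularAt (hΦ : Φ.IsMorphism A A') (hs : Φ.IsFiberwiseSurjective)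
    {L : TotalSpace F E → ℝ} {L' : TotalSpace F' E' → ℝ}
    (hL : ContMDiff (𝓘(ℝ, EM).prod 𝓘(ℝ, F)) 𝓘(ℝ, ℝ) ∞ L)
    (hL' : ContMDiff (𝓘(ℝ, EM').prod 𝓘(ℝ, F')) 𝓘(ℝ, ℝ) ∞ L')
    (h : ∀ a, L a = L' (Φ.total a)) {a : TotalSpace F E} (hreg : A.IsRegularAt L a) :
    A'.IsRegularAt L' (Φ.total a) := by
  intro z' hz'
  obtain ⟨z, rfl⟩ := prolong_surjective hΦ.isAdmissible hs a z'
  rw [hreg z fun w => (hΦ.cartanTwo_eq hΦ.isAdmissible hL hL' h a z w).trans (hz' _), map_zero]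

/-- The prolongation of a morphism sends solutions of the dynamical equation to solutions. -/
theorem IsMorphism.isDynamicsAt (hΦ : Φ.IsMorphism A A') (hs : Φ.IsFiberwiseSurjective)
    {L : TotalSpace F E → ℝ} {L' : TotalSpace F' E' → ℝ}
    (hL : ContMDiff (𝓘(ℝ, EM).prod 𝓘(ℝ, F)) 𝓘(ℝ, ℝ) ∞ L)
    (hL' : ContMDiff (𝓘(ℝ, EM').prod 𝓘(ℝ, F')) 𝓘(ℝ, ℝ) ∞ L')
    (h : ∀ a, L a = L' (Φ.total a)) {a : TotalSpace F E} {z : A.prol a}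
    (hz : A.IsDynamicsAt L a z) :
    A'.IsDynamicsAt L' (Φ.total a) (Φ.prolong hΦ.isAdmissible a z) := by
  intro w'
  obtain ⟨w, rfl⟩ := prolong_surjective hΦ.isAdmissible hs a w'
  rw [← hΦ.cartanTwo_eq hΦ.isAdmissible hL hL' h a z w, hz w]
  exact prolDFun_energy_eq hΦ.isAdmissible hL' h a w

theorem total_surjective (hb : Function.Surjective Φ.base) (hs : Φ.IsFiberwiseSurjective) :
    Function.Surjective Φ.total := by
  rintro ⟨x', b'⟩
  obtain ⟨x, rfl⟩ := hb x'
  obtain ⟨b, rfl⟩ := hs x b'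
  exact ⟨⟨x, b⟩, rfl⟩

end VBMap

end Morphisms

end LieAlgd

end

theorem mainTheorem4
    {EM : Type*} [NormedAddCommGroup EM] [NormedSpace ℝ EM] [FiniteDimensional ℝ EM]
    {M : Type*} [TopologicalSpace M] [T2Space M] [SigmaCompactSpace M]
    [ChartedSpace EM M] [IsManifold 𝓘(ℝ, EM) ∞ M]
    {F : Type*} [NormedAddCommGroup F] [NormedSpace ℝ F] [FiniteDimensional ℝ F]
    {E : M → Type*} [TopologicalSpace (TotalSpace F E)] [∀ x, TopologicalSpace (E x)]
    [∀ x, AddCommGroup (E x)] [∀ x, Module ℝ (E x)] [FiberBundle F E] [VectorBundle ℝ F E]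
    [ContMDiffVectorBundle ∞ F E 𝓘(ℝ, EM)]
    {EM' : Type*} [NormedAddCommGroup EM'] [NormedSpace ℝ EM'] [FiniteDimensional ℝ EM']
    {M' : Type*} [TopologicalSpace M'] [T2Space M'] [SigmaCompactSpace M']
    [ChartedSpace EM' M'] [IsManifold 𝓘(ℝ, EM') ∞ M']
    {F' : Type*} [NormedAddCommGroup F'] [NormedSpace ℝ F'] [FiniteDimensional ℝ F']
    {E' : M' → Type*} [TopologicalSpace (TotalSpace F' E')] [∀ x, TopologicalSpace (E' x)]
    [∀ x, AddCommGroup (E' x)] [∀ x, Module ℝ (E' x)] [FiberBundle F' E'] [VectorBundle ℝ F' E']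
    [ContMDiffVectorBundle ∞ F' E' 𝓘(ℝ, EM')]
    (A : LieAlgd.LieAlgebroid EM F E) (A' : LieAlgd.LieAlgebroid EM' F' E')
    (Φ : LieAlgd.VBMap EM F E EM' F' E') (hΦ : Φ.IsMorphism A A')
    (hsurj : Φ.IsFiberwiseSurjective)
    (L : C^∞⟮𝓘(ℝ, EM).prod 𝓘(ℝ, F), TotalSpace F E; ℝ⟯)
    (L' : C^∞⟮𝓘(ℝ, EM').prod 𝓘(ℝ, F'), TotalSpace F' E'; ℝ⟯)
    (hL : ∀ a, L a = L' (Φ.total a)) (hreg : A.IsRegular L) :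
    (Function.Surjective Φ.base → A'.IsRegular L') ∧
    ∃ hreg' : ∀ a, A'.IsRegularAt L' (Φ.total a),
      ∀ a, Φ.prolong hΦ.isAdmissible a (A.eulerLagrange L a (hreg a)) =
        A'.eulerLagrange L' (Φ.total a) (hreg' a) := by
  have hr : ∀ a, A'.IsRegularAt L' (Φ.total a) := fun a =>
    hΦ.isRegularAt hsurj L.contMDiff L'.contMDiff hL (hreg a)
  refine ⟨fun hb a' => ?_, hr, fun a => ?_⟩
  · obtain ⟨a, rfl⟩ := LieAlgd.VBMap.total_surjective hb hsurj a'
    exact hr a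
  -- `eulerLagrange` is a chosen solution, so the equality is uniqueness applied to two solutions at
  -- `Φ(a)`.
  · exact (A'.existsUnique_isDynamicsAt (hr a)).unique
      (hΦ.isDynamicsAt hsurj L.contMDiff L'.contMDiff hL
        (A.existsUnique_isDynamicsAt (hreg a)).choose_spec.1)
      (A'.existsUnique_isDynamicsAt (hr a)).choose_spec.1
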